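/- Let $n\ge 1$, $0<\alpha<n$, $2\le p<2n/\alpha$ and $A\ge 0$. For $S\subset\mathbb R^n$ let $\mathcal M^{*\alpha}(S)=\limsup_{\varepsilon\to0^+}(2\varepsilon)^{\alpha-n}|S(\varepsilon)|$ be its $\alpha$-dimensional upper Minkowski content, where $|S(\varepsilon)|$ is the Lebesgue measure of $S(\varepsilon)=\{x:\inf_{y\in S}|x-y|<\varepsilon\}$. There is a finite constant $C$, depending only on $n,\alpha,p$ and $A$, such that the following holds. Let $\nu$ be a non-zero finite Radon measure on $\mathbb R^n$ supported in a compact set $E$ (that is, $\nu(\mathbb R^n\setminus E)=0$) such that $0<\mathcal M^{*\alpha}(S)\le A\,\nu(S)$ for every compact $S\subset E$ with $\nu(S)\ne0$. Let $u$ be a tempered distribution on $\mathbb R^n$ with support contained in $E$ such that $$\limsup_{L\to\infty}\frac1{L^{n-\alpha p/2}}\int_{|\xi|\le L}|\widehat u(\xi)|^p\,d\xi<\infty .$$ Then there is $u_0\in L^2(\nu)$ with $u=u_0\,d\nu$, that is, $\langle u,\varphi\rangle=\int_E\varphi\,u_0\,d\nu$ for every Schwartz function $\varphi$, and $$\Big(\int_E|u_0|^2\,d\nu\Big)^{p/2}\le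 C\,\limsup_{L\to\infty}\frac1{L^{n-\alpha p/2}}\int_{|\xi|\le L}|\widehat u(\xi)|^p\,d\xi<\infty .$$ Here $\widehat u(\xi)=\langle u, e^{-2\pi i x\cdot\xi}\rangle$ is the Fourier transform of $u$, which is a function because $u$ has compact support. -/

import Mathlib

open MeasureTheory Filter Topology Set SchwartzMap FourierTransform
open scoped ENNReal NNReal

noncomputable section

/-- The `s`-dimensional upper Minkowski content of `A ⊆ ℝⁿ`, namely
`limsup_{ε → 0+} (2ε)^{s-n} |A(ε)|`, where `A(ε)` is the set of points at distance less than `ε`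
from `A`. -/
def upperMinkowskiContent {n : ℕ} (s : ℝ) (A : Set (EuclideanSpace ℝ (Fin n))) : ℝ≥0∞ :=
  limsup (fun ε : ℝ => ENNReal.ofReal ((2 * ε) ^ (s - (n : ℝ))) * volume (Metric.thickening ε A))
    (𝓝[>] 0)

/-- The tempered distribution `v` is (integration against) the locally integrable function `f`. -/
def IsFunctionDistribution {n : ℕ} (v : 𝓢'(EuclideanSpace ℝ (Fin n), ℂ))
    (f : EuclideanSpace ℝ (Fin n) → ℂ) : Prop :=
  LocallyIntegrable f volume ∧
    ∀ φ : 𝓢(EuclideanSpace ℝ (Fin n), ℂ), HasCompactSupport φ → v φ = ∫ ξ, φ ξ * f ξ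

/-- `∫_{|ξ| ≤ L} |v(ξ)|^p dξ` for a tempered distribution `v`. If `v` is a locally integrable
function then that function is unique up to null sets, so that the infimum is over one value;
if `v` is not a function the value is `∞`. -/
def lpMassOnBall {n : ℕ} (v : 𝓢'(EuclideanSpace ℝ (Fin n), ℂ)) (p L : ℝ) : ℝ≥0∞ :=
  ⨅ (f : EuclideanSpace ℝ (Fin n) → ℂ) (_ : IsFunctionDistribution v f),
    ∫⁻ ξ in Metric.closedBall 0 L, ‖f ξ‖ₑ ^ p

/-- `limsup_{L → ∞} L^{-(n - αp/2)} ∫_{|ξ| ≤ L} |û(ξ)|^p dξ`. -/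
def fourierLimsup {n : ℕ} (u : 𝓢'(EuclideanSpace ℝ (Fin n), ℂ)) (α p : ℝ) : ℝ≥0∞ :=
  limsup (fun L : ℝ => lpMassOnBall (𝓕 u) p L / ENNReal.ofReal (L ^ ((n : ℝ) - α * p / 2))) atTop

end

/-! Let `f` be the function representing `𝓕 u`. Hölder on balls (`lintegral_sq_closedBall_le`, where
`2 ≤ p` enters) reduces to `L²` growth: `∫_{|ξ| ≤ L} |f|² ≤ M L^(n-α)` for large `L`.

Test `u` against `χ_ε * φ`, where `χ_ε` is a mollifier supported in the ball of radius `ε` whose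
Fourier transform is `m(εξ)` with `m` Schwartz. Cauchy–Schwarz and Plancherel bound `|u(χ_ε * φ)|²`
by `∫ |f|² |m(-εξ)|² dξ · ‖φ‖₂²`, and a dyadic decomposition bounds the first factor by a multiple
of `M ε^(α-n)`. As `u` lives on `E`, only the values of `φ` on `E(3ε)` matter
(`enorm_apply_convolution_sq_le_thickening`).

What remains is `ε^(α-n) ∫_{E(3ε)} |φ|²`, a weighted Minkowski content. Slicing `E` into level sets
of `|φ|²` and applying the content hypothesis to each slice bounds its limsup by a multiple of `A ∫
|φ|² dν` (`limsup_lintegral_thickening_le`). Letting `ε → 0` gives `|u(φ)|² ≤ C M ∫ |φ|² dν`, and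
Riesz representation in `L²(ν)` yields `u₀`. -/

/-! ### Cutoffs of Schwartz functions and supports of distributions -/

section Cutoff

variable {V : Type*} [NormedAddCommGroup V] [InnerProductSpace ℝ V]

/-- There is a smooth cutoff function which is `1` on the unit ball. -/
theorem exists_smooth_cutoff (V : Type*) [NormedAddCommGroup V] [InnerProductSpace ℝ V]
    [FiniteDimensional ℝ V] :
    ∃ θ : V → ℝ, ContDiff ℝ (⊤ : ℕ∞) θ ∧ HasCompactSupport θ ∧ (∀ x, θ x ∈ Icc (0 : ℝ) 1) ∧
      (∀ x, ‖x‖ ≤ 1 → θ x = 1) := by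
  let b : ContDiffBump (0 : V) := ⟨1, 2, by norm_num, by norm_num⟩
  refine ⟨b, b.contDiff, b.hasCompactSupport, fun x => ⟨b.nonneg, b.le_one⟩, fun x hx => ?_⟩
  exact b.one_of_mem_closedBall (by simpa [b] using hx)

/-- The derivatives of `1 - θ` grow at most linearly away from the origin. -/
theorem norm_iteratedFDeriv_one_sub_cutoff_le {θ : V → ℝ} (hθ : ContDiff ℝ (⊤ : ℕ∞) θ)
    (hc : HasCompactSupport θ) (h1 : ∀ x, ‖x‖ ≤ 1 → θ x = 1) (i : ℕ) :
    ∃ C, 0 ≤ C ∧ ∀ y, ‖iteratedFDeriv ℝ i (fun x => 1 - θ x) y‖ ≤ C * ‖y‖ := by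
  have hsm : ContDiff ℝ (⊤ : ℕ∞) (fun x => 1 - θ x) := contDiff_const.sub hθ
  have hbd : ∃ C, ∀ y, ‖iteratedFDeriv ℝ i (fun x => 1 - θ x) y‖ ≤ C := by
    obtain ⟨C, hC⟩ := (hc.iteratedFDeriv (𝕜 := ℝ) i).exists_bound_of_continuous
      (hθ.continuous_iteratedFDeriv (m := i) (by exact_mod_cast le_top))
    obtain ⟨D, hD⟩ : ∃ D, ∀ y : V, ‖iteratedFDeriv ℝ i (fun _ : V => (1 : ℝ)) y‖ ≤ D := by
      rcases i with _ | i
      · exact ⟨1, fun y => by simp⟩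
      · exact ⟨0, fun y => by simp [iteratedFDeriv_succ_const]⟩
    refine ⟨D + C, fun y => ?_⟩
    rw [show (fun x => 1 - θ x) = (fun _ : V => (1 : ℝ)) - θ from rfl,
      iteratedFDeriv_sub_apply contDiff_const.contDiffAt
        (hθ.of_le (by exact_mod_cast le_top)).contDiffAt]
    exact (norm_sub_le _ _).trans (add_le_add (hD y) (hC y))
  obtain ⟨C, hC⟩ := hbd
  have hC0 : 0 ≤ C := (norm_nonneg _).trans (hC 0)
  refine ⟨C, hC0, fun y => ?_⟩
  -- Inside the unit ball `1 - θ` vanishes near `y`; outside it, `1 ≤ ‖y‖` turns the uniform bound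
  -- into a linear one.
  rcases lt_or_ge ‖y‖ 1 with hy | hy
  · have : (fun x => 1 - θ x) =ᶠ[𝓝 y] fun _ => (0 : ℝ) := by
      filter_upwards [(isOpen_lt continuous_norm continuous_const).mem_nhds hy] with z hz
      simp [h1 z (le_of_lt hz)]
    rw [this.iteratedFDeriv ℝ i |>.self_of_nhds]
    simp only [iteratedFDeriv_fun_zero]
    simpa using mul_nonneg hC0 (norm_nonneg y)
  · exact (hC y).trans (le_mul_of_one_le_right hC0 hy)

theorem hasTemperateGrowth_dilated_cutoff {θ : V → ℝ} (hθ : ContDiff ℝ (⊤ : ℕ∞) θ)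
    (hc : HasCompactSupport θ) {ε : ℝ} (hε : ε ≠ 0) :
    (fun x => (θ (ε • x) : ℂ)).HasTemperateGrowth := by
  have h2 : HasCompactSupport (fun x : V => θ (ε • x)) := hc.comp_smul hε
  have h3 : HasCompactSupport (fun x => (θ (ε • x) : ℂ)) :=
    h2.comp_left (g := fun r : ℝ => (r : ℂ)) (by simp)
  exact h3.hasTemperateGrowth
    (Complex.ofRealCLM.contDiff.comp (hθ.comp (contDiff_const_smul ε)))

/-- Each Leibniz term of `(1 - θ(ε·)) g` carries a derivative of the first factor, which is at most
`C ε ‖x‖`. The extra `‖x‖` is absorbed by a seminorm with weight `m + 1`, so every seminorm of the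
error is `O(ε)`. -/
theorem tendsto_smulLeftCLM_dilated_cutoff {θ : V → ℝ} (hθ : ContDiff ℝ (⊤ : ℕ∞) θ)
    (hc : HasCompactSupport θ) (h1 : ∀ x, ‖x‖ ≤ 1 → θ x = 1) (g : 𝓢(V, ℂ)) :
    Tendsto (fun k : ℕ => smulLeftCLM ℂ (fun x => (θ (((k : ℝ) + 1)⁻¹ • x) : ℂ)) g) atTop (𝓝 g) := by
  rw [(schwartz_withSeminorms ℝ V ℂ).tendsto_nhds]
  rintro ⟨m, l⟩ δ hδ
  choose C hC0 hC using fun i => norm_iteratedFDeriv_one_sub_cutoff_le hθ hc h1 i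
  set K : ℝ := ∑ i ∈ Finset.range (l + 1), (l.choose i : ℝ) * C i *
    SchwartzMap.seminorm ℝ (m + 1) (l - i) g with hK
  have hK0 : 0 ≤ K := Finset.sum_nonneg fun i _ =>
    mul_nonneg (mul_nonneg (by positivity) (hC0 i)) (apply_nonneg _ _)
  have key : ∀ k : ℕ, SchwartzMap.seminorm ℝ m l
      (smulLeftCLM ℂ (fun x => (θ (((k : ℝ) + 1)⁻¹ • x) : ℂ)) g - g) ≤ ((k : ℝ) + 1)⁻¹ * K := by
    intro k
    set ε : ℝ := ((k : ℝ) + 1)⁻¹ with hεd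
    have hε : 0 < ε := by positivity
    have hε1 : ε ≤ 1 := inv_le_one_of_one_le₀ (by linarith [(Nat.cast_nonneg k : (0 : ℝ) ≤ k)])
    have htg := hasTemperateGrowth_dilated_cutoff hθ hc hε.ne'
    refine SchwartzMap.seminorm_le_bound ℝ m l _ (by positivity) fun x => ?_
    have hfun : ((smulLeftCLM ℂ (fun x => (θ (ε • x) : ℂ)) g - g : 𝓢(V, ℂ)) : V → ℂ) =
        -(fun x => (1 - θ (ε • x)) • g x) := by
      ext x
      simp [smulLeftCLM_apply_apply htg]
      ring
    rw [hfun, iteratedFDeriv_neg_apply, norm_neg]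
    have hs : ContDiff ℝ (⊤ : ℕ∞) (fun x => 1 - θ x) := contDiff_const.sub hθ
    have hs' : ContDiff ℝ (⊤ : ℕ∞) (fun x => 1 - θ (ε • x)) :=
      contDiff_const.sub (hθ.comp (contDiff_const_smul ε))
    have hd : ∀ i, ‖iteratedFDeriv ℝ i (fun x => 1 - θ (ε • x)) x‖ ≤ C i * (ε * ‖x‖) := by
      intro i
      have := iteratedFDeriv_comp_const_smul (i := i) ε
        (hs.of_le (by exact_mod_cast le_top) : ContDiff ℝ i (fun x => 1 - θ x))
      have h2 := congrFun this x
      rw [h2, norm_smul]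
      have := hC i (ε • x)
      rw [norm_smul, Real.norm_of_nonneg hε.le] at this
      refine le_trans ?_ this
      refine mul_le_of_le_one_left (norm_nonneg _) ?_
      rw [norm_pow, Real.norm_of_nonneg hε.le]
      exact pow_le_one₀ hε.le hε1
    have hle := norm_iteratedFDeriv_smul_le hs' (g.smooth (⊤ : ℕ∞)) x (n := l)
      (by exact_mod_cast le_top)
    calc ‖x‖ ^ m * ‖iteratedFDeriv ℝ l (fun x => (1 - θ (ε • x)) • g x) x‖
        ≤ ‖x‖ ^ m * ∑ i ∈ Finset.range (l + 1), (l.choose i : ℝ) *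
            (C i * (ε * ‖x‖)) * ‖iteratedFDeriv ℝ (l - i) g x‖ := by
          refine mul_le_mul_of_nonneg_left (hle.trans (Finset.sum_le_sum fun i _ => ?_))
            (by positivity)
          gcongr
          exact hd i
      _ = ε * ∑ i ∈ Finset.range (l + 1), (l.choose i : ℝ) * C i *
            (‖x‖ ^ (m + 1) * ‖iteratedFDeriv ℝ (l - i) g x‖) := by
          rw [Finset.mul_sum, Finset.mul_sum]
          refine Finset.sum_congr rfl fun i _ => ?_
          ring
      _ ≤ ε * K := by
          refine mul_le_mul_of_nonneg_left (Finset.sum_le_sum fun i _ => ?_) hε.le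
          have := hC0 i
          gcongr
          exact SchwartzMap.le_seminorm ℝ _ _ g x
  have hlim : Tendsto (fun k : ℕ => ((k : ℝ) + 1)⁻¹ * K) atTop (𝓝 0) := by
    have : Tendsto (fun k : ℕ => ((k : ℝ) + 1)⁻¹) atTop (𝓝 0) := by
      simpa using tendsto_one_div_add_atTop_nhds_zero_nat (𝕜 := ℝ)
    simpa using this.mul_const K
  filter_upwards [hlim.eventually (gt_mem_nhds hδ)] with k hk
  exact (key k).trans_lt hk

variable [FiniteDimensional ℝ V]

/-- Every Schwartz function is a limit of compactly supported ones, dominated by it. -/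
theorem SchwartzMap.exists_tendsto_hasCompactSupport (g : 𝓢(V, ℂ)) :
    ∃ G : ℕ → 𝓢(V, ℂ), (∀ k, HasCompactSupport (G k)) ∧ (∀ k, tsupport (G k) ⊆ tsupport g) ∧
      (∀ k x, ‖G k x‖ ≤ ‖g x‖) ∧ (∀ x, Tendsto (fun k => G k x) atTop (𝓝 (g x))) ∧
      Tendsto G atTop (𝓝 g) := by
  obtain ⟨θ, hθ, hc, h01, h1⟩ := exists_smooth_cutoff V
  have hε : ∀ k : ℕ, ((k : ℝ) + 1)⁻¹ ≠ 0 := fun k => by positivity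
  have happ : ∀ (k : ℕ) x, smulLeftCLM ℂ (fun x => (θ (((k : ℝ) + 1)⁻¹ • x) : ℂ)) g x =
      (θ (((k : ℝ) + 1)⁻¹ • x) : ℂ) * g x := fun k x => by
    simp [smulLeftCLM_apply_apply (hasTemperateGrowth_dilated_cutoff hθ hc (hε k))]
  have hlim := tendsto_smulLeftCLM_dilated_cutoff hθ hc h1 g
  refine ⟨fun k => smulLeftCLM ℂ (fun x => (θ (((k : ℝ) + 1)⁻¹ • x) : ℂ)) g, fun k => ?_,
    fun k => ?_, fun k x => ?_, fun x => ?_, hlim⟩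
  · have h2 : HasCompactSupport (fun x : V => θ (((k : ℝ) + 1)⁻¹ • x)) := hc.comp_smul (hε k)
    refine h2.mono fun x hx => ?_
    simp only [Function.mem_support, happ] at hx ⊢
    intro h
    simp [h] at hx
  · refine closure_mono fun x hx => ?_
    simp only [Function.mem_support, happ] at hx ⊢
    exact right_ne_zero_of_mul hx
  · rw [happ, norm_mul]
    refine mul_le_of_le_one_left (norm_nonneg _) ?_
    rw [Complex.norm_real, Real.norm_of_nonneg (h01 _).1]
    exact (h01 _).2
  · refine tendsto_const_nhds.congr' ?_
    filter_upwards [eventually_ge_atTop ⌈‖x‖⌉₊] with k hk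
    rw [happ, h1, Complex.ofReal_one, one_mul]
    have : ‖x‖ ≤ k := (Nat.le_ceil _).trans (by exact_mod_cast hk)
    rw [norm_smul, Real.norm_of_nonneg (by positivity), inv_mul_le_iff₀ (by positivity)]
    linarith

/-- A tempered distribution vanishes on compactly supported test functions supported away from its
support. -/
theorem TemperedDistribution.eq_zero_of_hasCompactSupport_of_disjoint {u : 𝓢'(V, ℂ)} {g : 𝓢(V, ℂ)}
    (hgc : HasCompactSupport g) (hg : Disjoint (tsupport g) (Distribution.dsupport u)) :
    u g = 0 := by
  have hx : ∀ x : tsupport g, ∃ s : Set V, Distribution.IsVanishingOn u s ∧ IsOpen s ∧ (x : V) ∈ s :=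
    fun x => (Distribution.notMem_dsupport_iff (f := u) (x : V)).1 (disjoint_left.1 hg x.2)
  choose U hUv hUo hUm using hx
  obtain ⟨ρ, hρ⟩ := SmoothPartitionOfUnity.exists_isSubordinate (modelWithCornersSelf ℝ V)
    (isClosed_tsupport g) U hUo (fun x hx => mem_iUnion.2 ⟨⟨x, hx⟩, hUm ⟨x, hx⟩⟩)
  have hfin := ρ.locallyFinite.finite_nonempty_inter_compact hgc
  have hsm : ∀ i, ContDiff ℝ (⊤ : ℕ∞) (ρ i) := fun i => (ρ i).contMDiff.contDiff
  have hcs : ∀ i, HasCompactSupport (fun x => (ρ i x : ℂ) * g x) := fun i => hgc.mul_left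
  have hcd : ∀ i, ContDiff ℝ (⊤ : ℕ∞) (fun x => (ρ i x : ℂ) * g x) := fun i =>
    (Complex.ofRealCLM.contDiff.comp (hsm i)).mul (g.smooth _)
  -- Local finiteness and compactness of `tsupport g` leave finitely many pieces, each supported in
  -- an open set where `u` vanishes.
  have hsum : g = ∑ i ∈ hfin.toFinset, (hcs i).toSchwartzMap (hcd i) := by
    ext x
    simp only [sum_apply, HasCompactSupport.toSchwartzMap_toFun]
    rw [← Finset.sum_mul]
    by_cases hxg : x ∈ tsupport g
    · have h1 := ρ.sum_eq_one hxg
      rw [finsum_eq_sum_of_support_subset (s := hfin.toFinset)] at h1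
      · rw [← Complex.ofReal_sum, h1]; simp
      · intro i hi
        simp only [Finite.coe_toFinset, mem_ofPred_eq]
        exact ⟨x, hi, hxg⟩
    · simp [image_eq_zero_of_notMem_tsupport hxg]
  rw [hsum, map_sum]
  refine Finset.sum_eq_zero fun i _ => hUv i _ ?_
  refine Subset.trans ?_ (hρ i)
  refine closure_mono fun x hx => ?_
  simp only [Function.mem_support, HasCompactSupport.toSchwartzMap_toFun] at hx ⊢
  intro h
  simp [h] at hx

/-- A tempered distribution vanishes on Schwartz functions supported away from its support. -/
theorem TemperedDistribution.eq_zero_of_disjoint_dsupport {u : 𝓢'(V, ℂ)} {g : 𝓢(V, ℂ)}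
    (hg : Disjoint (tsupport g) (Distribution.dsupport u)) : u g = 0 := by
  obtain ⟨G, hGc, hGs, -, -, hG⟩ := g.exists_tendsto_hasCompactSupport
  have h0 : ∀ k, u (G k) = 0 := fun k =>
    TemperedDistribution.eq_zero_of_hasCompactSupport_of_disjoint (hGc k) (hg.mono_left (hGs k))
  have hu : Continuous (fun φ : 𝓢(V, ℂ) => u φ) := u.continuous
  have := (hu.tendsto g).comp hG
  exact tendsto_nhds_unique this (by simp [Function.comp_def, h0])

end Cutoff

/-! ### Dyadic summation against a decaying weight -/

section Weighted

/-- The constant `∑ₖ 2 ^ d * 2 ^ ((β - d) k)` of the dyadic summation below. -/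
noncomputable def dyadicConst (d : ℕ) (β : ℝ) : ℝ≥0∞ :=
  ∑' k : ℕ, ENNReal.ofReal (2 ^ d * ((2 : ℝ) ^ (β - d)) ^ k)

theorem dyadicConst_lt_top {d : ℕ} {β : ℝ} (h : β < d) : dyadicConst d β < ∞ := by
  have h1 : (2 : ℝ) ^ (β - d) < 1 := Real.rpow_lt_one_of_one_lt_of_neg (by norm_num) (by linarith)
  have hs : Summable fun k : ℕ => (2 : ℝ) ^ d * ((2 : ℝ) ^ (β - d)) ^ k :=
    (summable_geometric_of_lt_one (by positivity) h1).mul_left _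
  exact hs.tsum_ofReal_lt_top

/-- The single term with the least `k` such that `t ≤ 2 ^ k` suffices: minimality gives `2 ^ (k - 1)
< t` unless `k = 0`, and the factor `2 ^ d` pays for the lost dyadic step. -/
theorem inv_one_add_pow_le_tsum (d : ℕ) {t : ℝ} (ht : 0 ≤ t) :
    ENNReal.ofReal (((1 + t) ^ d)⁻¹) ≤
      ∑' k : ℕ, ENNReal.ofReal (2 ^ d * (((2 : ℝ) ^ d)⁻¹) ^ k) *
        (Iic ((2 : ℝ) ^ k)).indicator 1 t := by
  classical
  have hex : ∃ k : ℕ, t ≤ (2 : ℝ) ^ k :=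
    pow_unbounded_of_one_lt t (by norm_num) |>.imp fun _ h => h.le
  have hk := Nat.find_spec hex
  refine le_trans ?_ (ENNReal.le_tsum (Nat.find hex))
  rw [indicator_of_mem (show t ∈ Iic ((2 : ℝ) ^ Nat.find hex) from hk), Pi.one_apply, mul_one]
  refine ENNReal.ofReal_le_ofReal ?_
  rcases h0 : Nat.find hex with _ | k
  · rw [pow_zero, mul_one]
    exact (inv_le_one_of_one_le₀ (one_le_pow₀ (by linarith))).trans (one_le_pow₀ (by norm_num))
  · have hlt : (2 : ℝ) ^ k < t := not_le.1 (Nat.find_min hex (by omega))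
    have : (2 : ℝ) ^ d * (((2 : ℝ) ^ d)⁻¹) ^ (k + 1) = (((2 : ℝ) ^ k) ^ d)⁻¹ := by
      rw [pow_succ, inv_pow, ← pow_mul, ← pow_mul, mul_comm d k]
      field_simp
    rw [this]
    gcongr
    linarith

variable {V : Type*} [NormedAddCommGroup V] [MeasurableSpace V] [OpensMeasurableSpace V]
  {μ : Measure V}

/-- Growth of order `β` of the mass of balls controls integrals against a weight which decays
faster than `|ξ| ^ (-β)`, uniformly in the scale. -/
theorem lintegral_mul_weight_le {F : V → ℝ≥0∞} (hF : AEMeasurable F μ) {β L₀ : ℝ} {M : ℝ≥0∞}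
    (h : ∀ L, L₀ ≤ L → ∫⁻ ξ in Metric.closedBall 0 L, F ξ ∂μ ≤ M * ENNReal.ofReal (L ^ β))
    (d : ℕ) {ε : ℝ} (hε : 0 < ε) (hε' : L₀ ≤ ε⁻¹) :
    ∫⁻ ξ, F ξ * ENNReal.ofReal (((1 + ε * ‖ξ‖) ^ d)⁻¹) ∂μ ≤
      dyadicConst d β * M * ENNReal.ofReal (ε⁻¹ ^ β) := by
  set a : ℕ → ℝ≥0∞ := fun k => ENNReal.ofReal (2 ^ d * (((2 : ℝ) ^ d)⁻¹) ^ k)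
  have hind : ∀ (k : ℕ) (ξ : V), (Iic ((2 : ℝ) ^ k)).indicator (1 : ℝ → ℝ≥0∞) (ε * ‖ξ‖) =
      (Metric.closedBall (0 : V) (2 ^ k * ε⁻¹)).indicator 1 ξ := by
    intro k ξ
    have : ε * ‖ξ‖ ∈ Iic ((2 : ℝ) ^ k) ↔ ξ ∈ Metric.closedBall (0 : V) (2 ^ k * ε⁻¹) := by
      rw [mem_Iic, mem_closedBall_zero_iff, ← div_eq_mul_inv, le_div_iff₀ hε, mul_comm]
    by_cases hm : ξ ∈ Metric.closedBall (0 : V) (2 ^ k * ε⁻¹)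
    · rw [indicator_of_mem hm, indicator_of_mem (this.2 hm)]; rfl
    · rw [indicator_of_notMem hm, indicator_of_notMem (fun h => hm (this.1 h))]
  calc ∫⁻ ξ, F ξ * ENNReal.ofReal (((1 + ε * ‖ξ‖) ^ d)⁻¹) ∂μ
      ≤ ∫⁻ ξ, ∑' k : ℕ, a k * (Metric.closedBall (0 : V) (2 ^ k * ε⁻¹)).indicator F ξ ∂μ := by
        refine lintegral_mono fun ξ => ?_
        refine (mul_le_mul_right (inv_one_add_pow_le_tsum d (by positivity)) _).trans ?_
        rw [← ENNReal.tsum_mul_left]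
        refine ENNReal.tsum_le_tsum fun k => ?_
        rw [hind, ← mul_assoc, mul_comm (F ξ), mul_assoc]
        refine mul_le_mul_right ?_ _
        by_cases hm : ξ ∈ Metric.closedBall (0 : V) (2 ^ k * ε⁻¹) <;> simp [hm]
    _ = ∑' k : ℕ, a k * ∫⁻ ξ in Metric.closedBall (0 : V) (2 ^ k * ε⁻¹), F ξ ∂μ := by
        rw [lintegral_tsum fun k =>
          (hF.indicator Metric.isClosed_closedBall.measurableSet).const_mul _]
        refine tsum_congr fun k => ?_
        rw [lintegral_const_mul'' _ (hF.indicator Metric.isClosed_closedBall.measurableSet),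
          lintegral_indicator Metric.isClosed_closedBall.measurableSet]
    _ ≤ ∑' k : ℕ, ENNReal.ofReal (2 ^ d * ((2 : ℝ) ^ (β - d)) ^ k) *
          (M * ENNReal.ofReal (ε⁻¹ ^ β)) := by
        refine ENNReal.tsum_le_tsum fun k => ?_
        have h2 : L₀ ≤ 2 ^ k * ε⁻¹ := hε'.trans
          (le_mul_of_one_le_left (by positivity) (one_le_pow₀ (by norm_num)))
        refine (mul_le_mul_right (h _ h2) _).trans (le_of_eq ?_)
        rw [Real.mul_rpow (by positivity) (by positivity),
          ENNReal.ofReal_mul (by positivity)]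
        have : (2 : ℝ) ^ d * ((2 : ℝ) ^ (β - d)) ^ k =
            2 ^ d * (((2 : ℝ) ^ d)⁻¹) ^ k * ((2 : ℝ) ^ k) ^ β := by
          rw [Real.rpow_sub (by norm_num), Real.rpow_natCast, div_pow, inv_pow,
            ← Real.rpow_natCast ((2 : ℝ) ^ β), ← Real.rpow_mul (by norm_num),
            ← Real.rpow_natCast 2 k, ← Real.rpow_mul (by norm_num), mul_comm β]
          ring
        rw [this, ENNReal.ofReal_mul (by positivity)]
        simp only [a]
        ring
    _ = dyadicConst d β * M * ENNReal.ofReal (ε⁻¹ ^ β) := by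
        rw [ENNReal.tsum_mul_right, dyadicConst, mul_assoc]

end Weighted

/-! ### Distributions given by functions of moderate growth -/

section Extension

variable {n : ℕ}

theorem SchwartzMap.exists_norm_le_inv_one_add_pow {V : Type*} [NormedAddCommGroup V]
    [NormedSpace ℝ V] (φ : 𝓢(V, ℂ)) (d : ℕ) :
    ∃ C : ℝ, 0 ≤ C ∧ ∀ ξ, ‖φ ξ‖ ≤ C * ((1 + ‖ξ‖) ^ d)⁻¹ := by
  refine ⟨2 ^ d * ((Finset.Iic (d, 0)).sup fun m => SchwartzMap.seminorm ℝ m.1 m.2) φ,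
    mul_nonneg (by positivity) (apply_nonneg _ _), fun ξ => ?_⟩
  rw [← div_eq_mul_inv, le_div_iff₀ (by positivity), mul_comm]
  simpa using SchwartzMap.one_add_le_sup_seminorm_apply (𝕜 := ℝ) (m := (d, 0)) le_rfl le_rfl φ ξ

theorem integrable_schwartz_mul_of_growth {f : EuclideanSpace ℝ (Fin n) → ℂ}
    (hf : LocallyIntegrable f volume) {β L₀ : ℝ} {M : ℝ≥0∞} (hM : M ≠ ∞) (hβ : β < n)
    (h : ∀ L, L₀ ≤ L → ∫⁻ ξ in Metric.closedBall 0 L, ‖f ξ‖ₑ ^ 2 ≤ M * ENNReal.ofReal (L ^ β))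
    (φ : 𝓢(EuclideanSpace ℝ (Fin n), ℂ)) : Integrable (fun ξ => φ ξ * f ξ) := by
  have hfm := hf.aestronglyMeasurable
  refine ⟨φ.continuous.aestronglyMeasurable.mul hfm, ?_⟩
  -- This scale is admissible for the growth hypothesis (`L₀ ≤ ε⁻¹`), and `ε ≤ 1` lets the dilated
  -- weight dominate the undilated one.
  set ε : ℝ := (max L₀ 1)⁻¹ with hεd
  have hε : 0 < ε := by positivity
  have hε1 : ε ≤ 1 := inv_le_one_of_one_le₀ (le_max_right _ _)
  obtain ⟨C, hC0, hC⟩ := φ.exists_norm_le_inv_one_add_pow n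
  have hF : AEMeasurable (fun ξ => ‖f ξ‖ₑ ^ 2) volume := hfm.enorm.pow_const 2
  have hW := lintegral_mul_weight_le hF h n hε (by rw [hεd, inv_inv]; exact le_max_left _ _)
  have hφ : ∀ ξ, ‖φ ξ‖ₑ ≤ ENNReal.ofReal C * ENNReal.ofReal (((1 + ε * ‖ξ‖) ^ n)⁻¹) := by
    intro ξ
    rw [← ENNReal.ofReal_mul hC0, ← ofReal_norm]
    refine ENNReal.ofReal_le_ofReal ((hC ξ).trans ?_)
    gcongr
    exact mul_le_of_le_one_left (norm_nonneg _) hε1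
  have hle : ∀ ξ, ‖φ ξ * f ξ‖ₑ ≤ ‖φ ξ‖ₑ +
      ENNReal.ofReal C * (‖f ξ‖ₑ ^ 2 * ENNReal.ofReal (((1 + ε * ‖ξ‖) ^ n)⁻¹)) := by
    intro ξ
    rw [enorm_mul]
    -- Only the square of `f` is controlled; the summand `1` is harmless because `φ` is integrable.
    have h1 : ‖f ξ‖ₑ ≤ 1 + ‖f ξ‖ₑ ^ 2 := by
      rcases le_total ‖f ξ‖ₑ 1 with h | h
      · exact h.trans le_self_add
      · exact (le_self_pow₀ h two_ne_zero).trans le_add_self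
    calc ‖φ ξ‖ₑ * ‖f ξ‖ₑ ≤ ‖φ ξ‖ₑ * (1 + ‖f ξ‖ₑ ^ 2) := by gcongr
      _ = ‖φ ξ‖ₑ + ‖φ ξ‖ₑ * ‖f ξ‖ₑ ^ 2 := by ring
      _ ≤ _ := by
        refine add_le_add le_rfl ((mul_le_mul_left (hφ ξ) _).trans (le_of_eq ?_))
        ring
  refine (lintegral_mono hle).trans_lt ?_
  rw [lintegral_add_left' φ.continuous.aestronglyMeasurable.enorm,
    lintegral_const_mul' _ _ ENNReal.ofReal_ne_top]
  refine ENNReal.add_lt_top.2 ⟨φ.integrable.2, ENNReal.mul_lt_top ENNReal.ofReal_lt_top ?_⟩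
  refine hW.trans_lt (ENNReal.mul_lt_top (ENNReal.mul_lt_top (dyadicConst_lt_top hβ) hM.lt_top)
    ENNReal.ofReal_lt_top)

/-- A tempered distribution given on compactly supported test functions by a function of moderate
growth is given by that function on all Schwartz functions. -/
theorem IsFunctionDistribution.apply_eq_integral {v : 𝓢'(EuclideanSpace ℝ (Fin n), ℂ)}
    {f : EuclideanSpace ℝ (Fin n) → ℂ} (hv : IsFunctionDistribution v f)
    (hint : ∀ φ : 𝓢(EuclideanSpace ℝ (Fin n), ℂ), Integrable (fun ξ => φ ξ * f ξ))
    (φ : 𝓢(EuclideanSpace ℝ (Fin n), ℂ)) : v φ = ∫ ξ, φ ξ * f ξ := by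
  obtain ⟨G, hGc, -, hGb, hGp, hG⟩ := φ.exists_tendsto_hasCompactSupport
  have hvc : Continuous (fun φ : 𝓢(EuclideanSpace ℝ (Fin n), ℂ) => v φ) := v.continuous
  have h1 : Tendsto (fun k => v (G k)) atTop (𝓝 (v φ)) := (hvc.tendsto φ).comp hG
  simp_rw [fun k => hv.2 (G k) (hGc k)] at h1
  refine tendsto_nhds_unique h1 ?_
  refine tendsto_integral_of_dominated_convergence (fun ξ => ‖φ ξ * f ξ‖)
    (fun k => (hint (G k)).aestronglyMeasurable) (hint φ).norm (fun k => ?_) ?_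
  · filter_upwards with ξ
    rw [norm_mul, norm_mul]
    gcongr
    exact hGb k ξ
  · filter_upwards with ξ
    exact (hGp ξ).mul_const _

/-- The function representing a distribution is unique up to null sets. -/
theorem IsFunctionDistribution.ae_eq {v : 𝓢'(EuclideanSpace ℝ (Fin n), ℂ)}
    {f g : EuclideanSpace ℝ (Fin n) → ℂ} (hf : IsFunctionDistribution v f)
    (hg : IsFunctionDistribution v g) : f =ᵐ[volume] g := by
  refine ae_eq_of_integral_contDiff_smul_eq hf.1 hg.1 fun w hw hwc => ?_
  have hc : HasCompactSupport (fun x => (w x : ℂ)) :=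
    hwc.comp_left (g := fun r : ℝ => (r : ℂ)) (by simp)
  have hs : ContDiff ℝ (⊤ : ℕ∞) (fun x => (w x : ℂ)) := Complex.ofRealCLM.contDiff.comp hw
  have h1 := hf.2 (hc.toSchwartzMap hs) hc
  have h2 := hg.2 (hc.toSchwartzMap hs) hc
  simpa using h1.symm.trans h2

theorem IsFunctionDistribution.lpMassOnBall_eq {v : 𝓢'(EuclideanSpace ℝ (Fin n), ℂ)}
    {f : EuclideanSpace ℝ (Fin n) → ℂ} (hf : IsFunctionDistribution v f) (p L : ℝ) :
    lpMassOnBall v p L = ∫⁻ ξ in Metric.closedBall 0 L, ‖f ξ‖ₑ ^ p := by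
  refine le_antisymm (iInf₂_le f hf) (le_iInf₂ fun g hg => le_of_eq ?_)
  refine lintegral_congr_ae (ae_restrict_of_ae ?_)
  filter_upwards [hf.ae_eq hg] with ξ hξ
  rw [hξ]

end Extension

/-! ### Regularisation at scale `ε` -/

section Mollify

variable {n : ℕ}

/-- Smooth approximations of the Dirac mass, with the dilation of their Fourier transforms. -/
theorem exists_mollifier (n : ℕ) : ∃ m : 𝓢(EuclideanSpace ℝ (Fin n), ℂ), m 0 = 1 ∧
    ∀ ε : ℝ, 0 < ε → ∃ χ : 𝓢(EuclideanSpace ℝ (Fin n), ℂ),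
      Function.support χ ⊆ Metric.closedBall 0 ε ∧ ∀ ξ, 𝓕 χ ξ = m (ε • ξ) := by
  let b : ContDiffBump (0 : EuclideanSpace ℝ (Fin n)) := ⟨1 / 2, 1, by norm_num, by norm_num⟩
  set g : EuclideanSpace ℝ (Fin n) → ℂ := fun x => (b.normed volume x : ℂ) with hg
  have hgc : HasCompactSupport g :=
    b.hasCompactSupport_normed.comp_left (g := fun r : ℝ => (r : ℂ)) (by simp)
  have hgs : ContDiff ℝ (⊤ : ℕ∞) g := Complex.ofRealCLM.contDiff.comp b.contDiff_normed
  have hsupp : Function.support g ⊆ Metric.closedBall 0 1 := by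
    intro x hx
    have h2 : x ∈ Function.support (b.normed volume) := fun h => hx (by simp [hg, h])
    rw [b.support_normed_eq] at h2
    exact Metric.ball_subset_closedBall h2
  refine ⟨𝓕 (hgc.toSchwartzMap hgs), ?_, fun ε hε => ?_⟩
  · rw [SchwartzMap.fourier_coe, Real.fourier_eq]
    simp only [inner_zero_right, neg_zero, AddChar.map_zero_eq_one, one_smul,
      HasCompactSupport.toSchwartzMap_toFun, hg]
    rw [integral_complex_ofReal, b.integral_normed, Complex.ofReal_one]
  · have hc : HasCompactSupport (fun x => (((ε ^ n)⁻¹ : ℝ) : ℂ) * g (ε⁻¹ • x)) :=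
      HasCompactSupport.mul_left (f' := fun x => g (ε⁻¹ • x))
        (hgc.comp_smul (inv_ne_zero hε.ne'))
    have hs : ContDiff ℝ (⊤ : ℕ∞) (fun x => (((ε ^ n)⁻¹ : ℝ) : ℂ) * g (ε⁻¹ • x)) :=
      contDiff_const.mul (hgs.comp (contDiff_const_smul _))
    refine ⟨hc.toSchwartzMap hs, fun x hx => ?_, fun ξ => ?_⟩
    · rw [Function.mem_support, HasCompactSupport.toSchwartzMap_toFun] at hx
      have h1 := hsupp (right_ne_zero_of_mul hx)
      rw [mem_closedBall_zero_iff, norm_smul, Real.norm_of_nonneg (by positivity),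
        inv_mul_le_iff₀ hε, mul_one] at h1
      simpa using h1
    · rw [SchwartzMap.fourier_coe, SchwartzMap.fourier_coe, Real.fourier_eq, Real.fourier_eq]
      simp only [HasCompactSupport.toSchwartzMap_toFun]
      have h1 := Measure.integral_comp_smul_of_nonneg (volume : Measure (EuclideanSpace ℝ (Fin n)))
        (fun v => Real.fourierChar (-inner ℝ v (ε • ξ)) • g v) ε⁻¹ (hR := by positivity)
      have h2 : ∀ x : EuclideanSpace ℝ (Fin n), inner ℝ (ε⁻¹ • x) (ε • ξ) = inner ℝ x ξ := by
        intro x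
        rw [real_inner_smul_left, real_inner_smul_right]
        field_simp
      simp only [h2, finrank_euclideanSpace_fin] at h1
      have h3 : ∀ v : EuclideanSpace ℝ (Fin n), Real.fourierChar (-inner ℝ v ξ) •
          ((((ε ^ n)⁻¹ : ℝ) : ℂ) * g (ε⁻¹ • v)) =
          (((ε ^ n)⁻¹ : ℝ) : ℂ) * (Real.fourierChar (-inner ℝ v ξ) • g (ε⁻¹ • v)) := fun v => by
        simp only [Circle.smul_def, smul_eq_mul]; ring
      simp only [h3]
      rw [integral_const_mul, h1, ← Complex.real_smul, smul_smul]
      rw [inv_pow, inv_inv, inv_mul_cancel₀ (by positivity), one_smul]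

theorem SchwartzMap.fourierInv_apply_eq_fourier_neg (φ : 𝓢(EuclideanSpace ℝ (Fin n), ℂ))
    (ξ : EuclideanSpace ℝ (Fin n)) : 𝓕⁻ φ ξ = 𝓕 φ (-ξ) := by
  rw [SchwartzMap.fourierInv_apply_eq]; rfl

theorem apply_convolution_eq_integral {u : 𝓢'(EuclideanSpace ℝ (Fin n), ℂ)}
    {f : EuclideanSpace ℝ (Fin n) → ℂ}
    (hv : ∀ ψ : 𝓢(EuclideanSpace ℝ (Fin n), ℂ), (𝓕 u) ψ = ∫ ξ, ψ ξ * f ξ)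
    (χ φ : 𝓢(EuclideanSpace ℝ (Fin n), ℂ)) :
    u (convolution (ContinuousLinearMap.mul ℂ ℂ) χ φ) =
      ∫ ξ, 𝓕 χ (-ξ) * 𝓕⁻ φ ξ * f ξ := by
  have h1 : u (convolution (ContinuousLinearMap.mul ℂ ℂ) χ φ) =
      (𝓕 u) (𝓕⁻ (convolution (ContinuousLinearMap.mul ℂ ℂ) χ φ)) := by
    rw [TemperedDistribution.fourier_apply, fourier_fourierInv_eq]
  rw [h1, hv]
  refine integral_congr_ae (Eventually.of_forall fun ξ => ?_)
  simp only [SchwartzMap.fourierInv_apply_eq_fourier_neg, fourier_convolution,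
    pairing_apply_apply, ContinuousLinearMap.mul_apply']

theorem ENNReal.sq_lintegral_mul_le {α : Type*} [MeasurableSpace α] {μ : Measure α}
    {f g : α → ℝ≥0∞} (hf : AEMeasurable f μ) (hg : AEMeasurable g μ) :
    (∫⁻ a, f a * g a ∂μ) ^ 2 ≤ (∫⁻ a, f a ^ 2 ∂μ) * ∫⁻ a, g a ^ 2 ∂μ := by
  have h := ENNReal.lintegral_mul_le_Lp_mul_Lq μ Real.HolderConjugate.two_two hf hg
  simp only [Pi.mul_apply, ENNReal.rpow_two] at h
  refine (pow_le_pow_left' h 2).trans (le_of_eq ?_)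
  rw [mul_pow, ← ENNReal.rpow_two, ← ENNReal.rpow_two, ← ENNReal.rpow_mul, ← ENNReal.rpow_mul]
  norm_num

theorem SchwartzMap.lintegral_enorm_sq_fourierInv (φ : 𝓢(EuclideanSpace ℝ (Fin n), ℂ)) :
    ∫⁻ ξ, ‖𝓕⁻ φ ξ‖ₑ ^ 2 = ∫⁻ x, ‖φ x‖ₑ ^ 2 := by
  have key : ∀ ψ : 𝓢(EuclideanSpace ℝ (Fin n), ℂ),
      ∫⁻ x, ‖ψ x‖ₑ ^ 2 = ENNReal.ofReal (∫ x, ‖ψ x‖ ^ 2) := by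
    intro ψ
    rw [ofReal_integral_eq_lintegral_ofReal]
    · refine lintegral_congr fun x => ?_
      rw [ENNReal.ofReal_pow (norm_nonneg _), ofReal_norm]
    · exact (ψ.memLp 2).integrable_norm_pow two_ne_zero
    · exact Eventually.of_forall fun x => by positivity
  rw [key, key, ← SchwartzMap.integral_norm_sq_fourier (𝓕⁻ φ), fourier_fourierInv_eq]

/-- On the Fourier side the pairing is an integral of `𝓕 χ (-ξ) f(ξ)` against `𝓕⁻ φ`. Cauchy–Schwarz
splits it, Plancherel handles `φ`, and the decay of `m` makes the other factor a weighted integral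
of `|f|²`. -/
theorem enorm_apply_convolution_sq_le {u : 𝓢'(EuclideanSpace ℝ (Fin n), ℂ)}
    {f : EuclideanSpace ℝ (Fin n) → ℂ}
    (hv : ∀ ψ : 𝓢(EuclideanSpace ℝ (Fin n), ℂ), (𝓕 u) ψ = ∫ ξ, ψ ξ * f ξ)
    (hf : AEStronglyMeasurable f volume) {β L₀ : ℝ} {M : ℝ≥0∞}
    (h : ∀ L, L₀ ≤ L → ∫⁻ ξ in Metric.closedBall 0 L, ‖f ξ‖ₑ ^ 2 ≤ M * ENNReal.ofReal (L ^ β))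
    {m : 𝓢(EuclideanSpace ℝ (Fin n), ℂ)} {C : ℝ}
    (hm : ∀ ξ, ‖m ξ‖ ≤ C * ((1 + ‖ξ‖) ^ n)⁻¹)
    {ε : ℝ} (hε : 0 < ε) (hε' : L₀ ≤ ε⁻¹) {χ : 𝓢(EuclideanSpace ℝ (Fin n), ℂ)}
    (hχ : ∀ ξ, 𝓕 χ ξ = m (ε • ξ)) (φ : 𝓢(EuclideanSpace ℝ (Fin n), ℂ)) :
    ‖u (convolution (ContinuousLinearMap.mul ℂ ℂ) χ φ)‖ₑ ^ 2 ≤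
      ENNReal.ofReal (C ^ 2) * (dyadicConst n β * M * ENNReal.ofReal (ε⁻¹ ^ β)) *
        ∫⁻ x, ‖φ x‖ₑ ^ 2 := by
  have hF : AEMeasurable (fun ξ => ‖f ξ‖ₑ ^ 2) volume := hf.enorm.pow_const 2
  have hW := lintegral_mul_weight_le hF h n hε hε'
  rw [apply_convolution_eq_integral hv]
  have h1 : ‖∫ ξ, 𝓕 χ (-ξ) * 𝓕⁻ φ ξ * f ξ‖ₑ ≤
      ∫⁻ ξ, (‖𝓕 χ (-ξ)‖ₑ * ‖f ξ‖ₑ) * ‖𝓕⁻ φ ξ‖ₑ := by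
    refine (enorm_integral_le_lintegral_enorm _).trans (le_of_eq (lintegral_congr fun ξ => ?_))
    rw [enorm_mul, enorm_mul]; ring
  have hχm : AEMeasurable (fun ξ => ‖𝓕 χ (-ξ)‖ₑ) volume :=
    ((𝓕 χ).continuous.comp continuous_neg).aestronglyMeasurable.enorm
  refine (pow_le_pow_left' h1 2).trans ((ENNReal.sq_lintegral_mul_le (hχm.mul hf.enorm)
    (𝓕⁻ φ).continuous.aestronglyMeasurable.enorm).trans ?_)
  rw [φ.lintegral_enorm_sq_fourierInv]
  refine mul_le_mul_left ?_ _
  refine le_trans ?_ (mul_le_mul_right hW _)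
  rw [← lintegral_const_mul' _ _ ENNReal.ofReal_ne_top]
  refine lintegral_mono fun ξ => ?_
  have hb : ‖𝓕 χ (-ξ)‖ₑ ^ 2 ≤
      ENNReal.ofReal (C ^ 2) * ENNReal.ofReal (((1 + ε * ‖ξ‖) ^ n)⁻¹) := by
    rw [← ENNReal.ofReal_mul (by positivity), ← ofReal_norm, ← ENNReal.ofReal_pow (norm_nonneg _)]
    refine ENNReal.ofReal_le_ofReal ?_
    have h2 := hm (ε • (-ξ))
    rw [← hχ, norm_smul, norm_neg, Real.norm_of_nonneg hε.le] at h2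
    -- Squaring produces the weight twice; one copy is enough, so the other is bounded by `1`.
    have h3 : ((1 + ε * ‖ξ‖) ^ n)⁻¹ ≤ 1 :=
      inv_le_one_of_one_le₀ (one_le_pow₀ (by linarith [mul_nonneg hε.le (norm_nonneg ξ)]))
    calc ‖𝓕 χ (-ξ)‖ ^ 2 ≤ (C * ((1 + ε * ‖ξ‖) ^ n)⁻¹) ^ 2 := by gcongr
      _ = C ^ 2 * (((1 + ε * ‖ξ‖) ^ n)⁻¹ * ((1 + ε * ‖ξ‖) ^ n)⁻¹) := by ring
      _ ≤ C ^ 2 * (((1 + ε * ‖ξ‖) ^ n)⁻¹ * 1) := by gcongr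
      _ = _ := by ring
  rw [Pi.mul_apply, mul_pow]
  refine (mul_le_mul_left hb _).trans (le_of_eq ?_)
  ring

/-- The regularisation at scale `ε` of a distribution supported in `E` only sees the
`3ε`-neighbourhood of `E`. -/
theorem enorm_apply_convolution_sq_le_thickening {u : 𝓢'(EuclideanSpace ℝ (Fin n), ℂ)}
    {E : Set (EuclideanSpace ℝ (Fin n))} (hE : IsCompact E) (hu : Distribution.dsupport u ⊆ E)
    {ε : ℝ} (hε : 0 < ε) {χ : 𝓢(EuclideanSpace ℝ (Fin n), ℂ)}
    (hχ : Function.support χ ⊆ Metric.closedBall 0 ε) {K : ℝ≥0∞}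
    (hK : ∀ φ : 𝓢(EuclideanSpace ℝ (Fin n), ℂ),
      ‖u (convolution (ContinuousLinearMap.mul ℂ ℂ) χ φ)‖ₑ ^ 2 ≤ K * ∫⁻ x, ‖φ x‖ₑ ^ 2)
    (φ : 𝓢(EuclideanSpace ℝ (Fin n), ℂ)) :
    ‖u (convolution (ContinuousLinearMap.mul ℂ ℂ) χ φ)‖ₑ ^ 2 ≤
      K * ∫⁻ x in Metric.thickening (3 * ε) E, ‖φ x‖ₑ ^ 2 := by
  obtain ⟨θ, hθ0, hθ1, hθ01⟩ := exists_contMDiffMap_zero_one_of_isClosed (n := (⊤ : ℕ∞))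
    (modelWithCornersSelf ℝ (EuclideanSpace ℝ (Fin n)))
    (Metric.isOpen_thickening (δ := 3 * ε) (E := E)).isClosed_compl
    (Metric.isClosed_cthickening (δ := 2 * ε) (E := E))
    (disjoint_compl_left_iff_subset.2
      (Metric.cthickening_subset_thickening' (by linarith) (by linarith) E))
  have hθs : ContDiff ℝ (⊤ : ℕ∞) θ := θ.contMDiff.contDiff
  have hθsupp : Function.support θ ⊆ Metric.thickening (3 * ε) E := fun x hx => by
    by_contra hx'
    exact hx (hθ0 hx')
  have hθc : HasCompactSupport θ := by
    refine HasCompactSupport.of_support_subset_isCompact (hE.cthickening (r := 3 * ε))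
      (hθsupp.trans (Metric.thickening_subset_cthickening _ _))
  have hc : HasCompactSupport (fun x => (θ x : ℂ) * φ x) :=
    HasCompactSupport.mul_right (f := fun x => (θ x : ℂ))
      (hθc.comp_left (g := fun r : ℝ => (r : ℂ)) (by simp))
  have hs : ContDiff ℝ (⊤ : ℕ∞) (fun x => (θ x : ℂ) * φ x) :=
    (Complex.ofRealCLM.contDiff.comp hθs).mul (φ.smooth _)
  set φ₁ := hc.toSchwartzMap hs with hφ₁
  have hφ₁a : ∀ x, φ₁ x = (θ x : ℂ) * φ x := fun x => rfl
  -- `φ - φ₁` vanishes on the closed `2ε`-neighbourhood of `E` and `χ` has radius `ε`, so their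
  -- convolution vanishes on the open set `E(ε)`, and even its closed support misses `E`.
  have hz : u (convolution (ContinuousLinearMap.mul ℂ ℂ) χ (φ - φ₁)) = 0 := by
    refine TemperedDistribution.eq_zero_of_disjoint_dsupport (Disjoint.mono_right hu ?_)
    have hsub : tsupport (convolution (ContinuousLinearMap.mul ℂ ℂ) χ (φ - φ₁)) ⊆
        (Metric.thickening ε E)ᶜ := by
      refine closure_minimal ?_ Metric.isOpen_thickening.isClosed_compl
      intro x hx hxE
      rw [Function.mem_support, convolution_apply] at hx
      obtain ⟨y, hy, z, hz, rfl⟩ := support_convolution_subset _ hx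
      have hz' : z ∉ Metric.cthickening (2 * ε) E := by
        intro hzc
        refine hz ?_
        rw [sub_apply, hφ₁a, hθ1 hzc]
        simp
      obtain ⟨e, heE, he⟩ := Metric.mem_thickening_iff.1 hxE
      refine hz' (Metric.mem_cthickening_of_dist_le z e _ E heE ?_)
      have hy' := hχ hy
      rw [mem_closedBall_zero_iff] at hy'
      calc dist z e ≤ dist z (y + z) + dist (y + z) e := dist_triangle _ _ _
        _ ≤ ε + ε := by
          refine add_le_add ?_ he.le
          rw [dist_comm, dist_eq_norm]; simpa using hy'
        _ = 2 * ε := by ring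
    exact Disjoint.mono_left hsub (disjoint_compl_left_iff_subset.2
      (Metric.self_subset_thickening hε E))
  have heq : u (convolution (ContinuousLinearMap.mul ℂ ℂ) χ φ) =
      u (convolution (ContinuousLinearMap.mul ℂ ℂ) χ φ₁) := by
    rw [map_sub, map_sub, sub_eq_zero] at hz
    exact hz
  rw [heq]
  refine (hK φ₁).trans (mul_le_mul_right ?_ _)
  rw [← lintegral_indicator Metric.isOpen_thickening.measurableSet]
  refine lintegral_mono fun x => ?_
  by_cases hx : x ∈ Metric.thickening (3 * ε) E
  · rw [indicator_of_mem hx, hφ₁a, enorm_mul]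
    gcongr
    refine mul_le_of_le_one_left zero_le ?_
    rw [← ofReal_norm, Complex.norm_real, Real.norm_of_nonneg (hθ01 x).1]
    exact ENNReal.ofReal_le_one.2 (hθ01 x).2
  · rw [indicator_of_notMem hx, hφ₁a, hθ0 hx]
    simp

theorem tendsto_apply_convolution {u : 𝓢'(EuclideanSpace ℝ (Fin n), ℂ)}
    {f : EuclideanSpace ℝ (Fin n) → ℂ}
    (hv : ∀ ψ : 𝓢(EuclideanSpace ℝ (Fin n), ℂ), (𝓕 u) ψ = ∫ ξ, ψ ξ * f ξ)
    (hint : ∀ ψ : 𝓢(EuclideanSpace ℝ (Fin n), ℂ), Integrable (fun ξ => ψ ξ * f ξ))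
    (hf : AEStronglyMeasurable f volume)
    {m : 𝓢(EuclideanSpace ℝ (Fin n), ℂ)} (hm : m 0 = 1)
    {χ : ℝ → 𝓢(EuclideanSpace ℝ (Fin n), ℂ)} (hχ : ∀ ε, 0 < ε → ∀ ξ, 𝓕 (χ ε) ξ = m (ε • ξ))
    (φ : 𝓢(EuclideanSpace ℝ (Fin n), ℂ)) :
    Tendsto (fun ε => u (convolution (ContinuousLinearMap.mul ℂ ℂ) (χ ε) φ)) (𝓝[>] 0)
      (𝓝 (u φ)) := by
  have h1 : u φ = ∫ ξ, 𝓕⁻ φ ξ * f ξ := by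
    rw [← hv, TemperedDistribution.fourier_apply, fourier_fourierInv_eq]
  rw [h1]
  simp_rw [apply_convolution_eq_integral hv]
  -- Exponent `0` gives just boundedness of `m`, enough for domination.
  obtain ⟨C, hC0, hC⟩ := m.exists_norm_le_inv_one_add_pow 0
  simp only [pow_zero, inv_one, mul_one] at hC
  have hpos : ∀ᶠ ε : ℝ in 𝓝[>] 0, 0 < ε := eventually_mem_nhdsWithin
  refine tendsto_integral_filter_of_dominated_convergence (fun ξ => C * ‖𝓕⁻ φ ξ * f ξ‖)
    (Eventually.of_forall fun ε => ?_) ?_ ((hint _).norm.const_mul C) ?_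
  · exact (((𝓕 (χ ε)).continuous.comp continuous_neg).aestronglyMeasurable.mul
      (𝓕⁻ φ).continuous.aestronglyMeasurable).mul hf
  · filter_upwards [hpos] with ε hε
    filter_upwards with ξ
    rw [mul_assoc, norm_mul, hχ ε hε]
    gcongr
    exact hC _
  · filter_upwards with ξ
    refine Tendsto.mul_const _ ?_
    have h2 : Tendsto (fun ε : ℝ => m (ε • (-ξ)) * 𝓕⁻ φ ξ) (𝓝[>] 0) (𝓝 (𝓕⁻ φ ξ)) := by
      have h3 : Continuous fun ε : ℝ => m (ε • (-ξ)) * 𝓕⁻ φ ξ :=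
        (m.continuous.comp (continuous_id.smul continuous_const)).mul continuous_const
      have h4 := h3.tendsto 0
      simp only [zero_smul, hm, one_mul] at h4
      exact h4.mono_left nhdsWithin_le_nhds
    refine h2.congr' ?_
    filter_upwards [hpos] with ε hε
    rw [hχ ε hε]

end Mollify

/-! ### Minkowski content and averages over neighbourhoods -/

section Minkowski

theorem ENNReal.limsup_add_le_add {ι : Type*} {l : Filter ι} (u v : ι → ℝ≥0∞) :
    limsup (fun i => u i + v i) l ≤ limsup u l + limsup v l := by
  refine ENNReal.le_of_forall_pos_le_add fun δ hδ hfin => ?_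
  have hδ2 : ((δ / 2 : ℝ≥0) : ℝ≥0∞) ≠ 0 := by
    simpa using hδ.ne'
  have hu := eventually_lt_of_limsup_lt
    (ENNReal.lt_add_right ((ENNReal.add_lt_top.1 hfin).1.ne) hδ2)
  have hv := eventually_lt_of_limsup_lt
    (ENNReal.lt_add_right ((ENNReal.add_lt_top.1 hfin).2.ne) hδ2)
  refine limsup_le_of_le (h := ?_)
  filter_upwards [hu, hv] with i h1 h2
  refine (add_le_add h1.le h2.le).trans (le_of_eq ?_)
  have : (δ : ℝ≥0∞) = ((δ / 2 : ℝ≥0) : ℝ≥0∞) + ((δ / 2 : ℝ≥0) : ℝ≥0∞) := by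
    rw [← ENNReal.coe_add, add_halves]
  rw [this]
  ring

theorem ENNReal.limsup_sum_le_sum {ι κ : Type*} {l : Filter ι} (s : Finset κ)
    (u : κ → ι → ℝ≥0∞) :
    limsup (fun i => ∑ k ∈ s, u k i) l ≤ ∑ k ∈ s, limsup (u k) l := by
  classical
  induction s using Finset.induction_on with
  | empty => simpa using (limsup_const_bot (f := l) (α := ℝ≥0∞)).le
  | insert a s ha ih =>
    simp only [Finset.sum_insert ha]
    exact (ENNReal.limsup_add_le_add _ _).trans (add_le_add le_rfl ih)

theorem setLIntegral_biUnion_finset_le {X κ : Type*} [MeasurableSpace X] {μ : Measure X}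
    (s : Finset κ) (T : κ → Set X) (f : X → ℝ≥0∞) :
    ∫⁻ x in ⋃ k ∈ s, T k, f x ∂μ ≤ ∑ k ∈ s, ∫⁻ x in T k, f x ∂μ := by
  classical
  induction s using Finset.induction_on with
  | empty => simp
  | insert a s ha ih =>
    rw [Finset.set_biUnion_insert, Finset.sum_insert ha]
    exact (lintegral_union_le _ _ _).trans (add_le_add le_rfl ih)

variable {n : ℕ} {α : ℝ}

theorem upperMinkowskiContent_mono {S T : Set (EuclideanSpace ℝ (Fin n))} (h : S ⊆ T) :
    upperMinkowskiContent α S ≤ upperMinkowskiContent α T :=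
  limsup_le_limsup (Eventually.of_forall fun ε =>
    mul_le_mul_right (measure_mono (Metric.thickening_subset_of_subset ε h)) _)

theorem upperMinkowskiContent_singleton (hα : 0 < α) (x : EuclideanSpace ℝ (Fin n)) :
    upperMinkowskiContent α {x} = 0 := by
  refine Tendsto.limsup_eq ?_
  set c : ℝ≥0∞ := volume (Metric.ball (0 : EuclideanSpace ℝ (Fin n)) 1)
  have hc : c ≠ ∞ := measure_ball_lt_top.ne
  have h1 : Tendsto (fun ε : ℝ => (2 : ℝ) ^ (α - n) * ε ^ α) (𝓝[>] 0) (𝓝 0) := by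
    have h2 : Tendsto (fun ε : ℝ => ε ^ α) (𝓝 0) (𝓝 0) := by
      have := (Real.continuousAt_rpow_const 0 α (Or.inr hα.le)).tendsto
      rwa [Real.zero_rpow hα.ne'] at this
    simpa using (h2.mono_left nhdsWithin_le_nhds).const_mul ((2 : ℝ) ^ (α - n))
  have h3 : Tendsto (fun ε : ℝ => ENNReal.ofReal ((2 : ℝ) ^ (α - n) * ε ^ α) * c) (𝓝[>] 0) (𝓝 0) := by
    have := ENNReal.Tendsto.mul_const (ENNReal.tendsto_ofReal h1) (b := c) (Or.inr hc)
    simpa using this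
  refine h3.congr' ?_
  filter_upwards [self_mem_nhdsWithin] with ε (hε : 0 < ε)
  rw [Metric.thickening_singleton, Measure.addHaar_ball_of_pos _ _ hε, finrank_euclideanSpace_fin,
    ← mul_assoc, ← ENNReal.ofReal_mul (by positivity)]
  congr 2
  rw [Real.mul_rpow (by norm_num) hε.le, mul_assoc, ← Real.rpow_natCast, ← Real.rpow_add hε,
    sub_add_cancel]

/-- If the Minkowski content of sets of positive measure is positive and controlled by the measure,
then the control holds for null sets as well. -/
theorem upperMinkowskiContent_le_of_pos {E : Set (EuclideanSpace ℝ (Fin n))}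
    {ν : Measure (EuclideanSpace ℝ (Fin n))} [IsFiniteMeasure ν] (hα : 0 < α) (hE : IsCompact E)
    (hνE : ν Eᶜ = 0) (hν : ν ≠ 0) {A : ℝ≥0}
    (h : ∀ S ⊆ E, IsCompact S → ν S ≠ 0 →
      0 < upperMinkowskiContent α S ∧ upperMinkowskiContent α S ≤ A * ν S)
    {S : Set (EuclideanSpace ℝ (Fin n))} (hSE : S ⊆ E) (hS : IsCompact S) :
    upperMinkowskiContent α S ≤ A * ν S := by
  -- A point has zero content since `α > 0`, so an atom would contradict positivity of the content.
  have hatom : ∀ x, ν {x} = 0 := by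
    intro x
    by_contra hx
    by_cases hxE : x ∈ E
    · have := (h {x} (singleton_subset_iff.2 hxE) isCompact_singleton hx).1
      rw [upperMinkowskiContent_singleton hα] at this
      exact lt_irrefl _ this
    · exact hx (measure_mono_null (singleton_subset_iff.2 hxE) hνE)
  by_cases hνS : ν S = 0
  -- Enlarge the null set `S` by the part of `E` in a small ball about a point of the support. The
  -- union has positive measure, so the hypothesis applies, and that measure tends to `ν {x} = 0`.
  · obtain ⟨x, hx⟩ := Measure.nonempty_support hν
    rw [Measure.mem_support_iff_forall] at hx
    have hlim : Tendsto (fun r => A * ν (Metric.cthickening r {x})) (𝓝[>] 0) (𝓝 (A * ν {x})) := by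
      refine ENNReal.Tendsto.const_mul ?_ (Or.inr ENNReal.coe_ne_top)
      exact (tendsto_measure_cthickening_of_isClosed ⟨1, one_pos, measure_ne_top _ _⟩
        isClosed_singleton).mono_left nhdsWithin_le_nhds
    rw [hatom, ← hνS] at hlim
    refine ge_of_tendsto hlim ?_
    filter_upwards [self_mem_nhdsWithin] with r (hr : 0 < r)
    have hpos : ν (Metric.cthickening r {x}) ≠ 0 := (hx _ (by
      rw [Metric.cthickening_singleton _ hr.le]
      exact Metric.closedBall_mem_nhds x hr)).ne'
    set T := S ∪ E ∩ Metric.cthickening r {x} with hT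
    have hTle : ν T ≤ ν (Metric.cthickening r {x}) := by
      refine (measure_union_le _ _).trans ?_
      rw [hνS, zero_add]
      exact measure_mono inter_subset_right
    have hTge : ν (Metric.cthickening r {x}) ≤ ν T := by
      rw [← measure_inter_add_sdiff (Metric.cthickening r {x}) hE.isClosed.measurableSet]
      rw [measure_mono_null (fun y hy => hy.2 : Metric.cthickening r {x} \ E ⊆ Eᶜ) hνE, add_zero]
      exact measure_mono fun y hy => Or.inr ⟨hy.2, hy.1⟩
    have hTc : IsCompact T := hS.union (hE.inter_right Metric.isClosed_cthickening)
    have h2 := (h T (union_subset hSE inter_subset_left) hTc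
      (fun h0 => hpos (le_antisymm (hTge.trans h0.le) zero_le))).2
    exact (upperMinkowskiContent_mono subset_union_left).trans
      (h2.trans (mul_le_mul_right hTle _))
  · exact (h S hSE hS hνS).2

/-- The slices are closed, to keep them compact, hence overlap at endpoints; a point lies in at most
two. This is the source of the factor `2` below. -/
theorem sum_indicator_levelSets_le {X : Type*} (E : Set X) (ψ : X → ℝ) {η : ℝ} (hη : 0 < η) (N : ℕ)
    (g : X → ℝ≥0∞) (x : X) :
    ∑ k ∈ Finset.range N, {x ∈ E | k * η ≤ ψ x ∧ ψ x ≤ (k + 1) * η}.indicator g x ≤ 2 * g x := by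
  classical
  simp only [indicator_apply]
  rw [← Finset.sum_filter, Finset.sum_const, nsmul_eq_mul]
  refine mul_le_mul_left ?_ _
  have hsub : (Finset.range N).filter
      (fun k : ℕ => x ∈ {x ∈ E | k * η ≤ ψ x ∧ ψ x ≤ (k + 1) * η}) ⊆
      {⌊ψ x / η⌋₊, ⌊ψ x / η⌋₊ - 1} := by
    intro k hk
    obtain ⟨-, -, h1, h2⟩ := Finset.mem_filter.1 hk
    rw [← le_div_iff₀ hη] at h1
    rw [← div_le_iff₀ hη] at h2
    have h3 : k ≤ ⌊ψ x / η⌋₊ := Nat.le_floor h1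
    have h4 : ⌊ψ x / η⌋₊ ≤ k + 1 := Nat.floor_le_of_le (by exact_mod_cast h2)
    simp only [Finset.mem_insert, Finset.mem_singleton]
    omega
  exact_mod_cast (Finset.card_le_card hsub).trans Finset.card_le_two

/-- Averages of a continuous function over small neighbourhoods of `E` are controlled by its
integral against any measure which dominates the Minkowski content. -/
theorem limsup_lintegral_thickening_le {E : Set (EuclideanSpace ℝ (Fin n))}
    {ν : Measure (EuclideanSpace ℝ (Fin n))} [IsFiniteMeasure ν] (hE : IsCompact E) {A : ℝ≥0}
    (h : ∀ S ⊆ E, IsCompact S → upperMinkowskiContent α S ≤ A * ν S)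
    {ψ : EuclideanSpace ℝ (Fin n) → ℝ} (hψ : Continuous ψ) (hψ0 : ∀ x, 0 ≤ ψ x) :
    limsup (fun ε : ℝ => ENNReal.ofReal ((2 * ε) ^ (α - (n : ℝ))) *
      ∫⁻ x in Metric.thickening ε E, ENNReal.ofReal (ψ x)) (𝓝[>] 0) ≤
      2 * A * ∫⁻ x, ENNReal.ofReal (ψ x) ∂ν := by
  have key : ∀ η : ℝ, 0 < η → limsup (fun ε : ℝ => ENNReal.ofReal ((2 * ε) ^ (α - (n : ℝ))) *
      ∫⁻ x in Metric.thickening ε E, ENNReal.ofReal (ψ x)) (𝓝[>] 0) ≤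
      2 * A * (∫⁻ x, ENNReal.ofReal (ψ x) ∂ν + ENNReal.ofReal (2 * η) * ν univ) := by
    intro η hη
    obtain ⟨N, hN⟩ : ∃ N : ℕ, ∀ x ∈ E, ψ x < N * η := by
      obtain ⟨B, hB⟩ := (hE.image hψ).bddAbove
      obtain ⟨N, hN⟩ := exists_nat_gt (B / η)
      refine ⟨N, fun x hx => ?_⟩
      rw [div_lt_iff₀ hη] at hN
      exact (hB (mem_image_of_mem _ hx)).trans_lt hN
    set S : ℕ → Set (EuclideanSpace ℝ (Fin n)) :=
      fun k => {x ∈ E | k * η ≤ ψ x ∧ ψ x ≤ (k + 1) * η} with hSdef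
    have hSE : ∀ k, S k ⊆ E := fun k x hx => hx.1
    have hSc : ∀ k, IsCompact (S k) := fun k => hE.inter_right
      ((isClosed_le continuous_const hψ).inter (isClosed_le hψ continuous_const))
    have hcov : E ⊆ ⋃ k ∈ Finset.range N, S k := by
      intro x hx
      have h1 : 0 ≤ ψ x / η := div_nonneg (hψ0 x) hη.le
      refine mem_iUnion₂.2 ⟨⌊ψ x / η⌋₊, ?_, hx, ?_, ?_⟩
      · rw [Finset.mem_range, Nat.floor_lt h1, div_lt_iff₀ hη]
        exact hN x hx
      · rw [← le_div_iff₀ hη]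
        exact Nat.floor_le h1
      · rw [← div_le_iff₀ hη]
        exact (Nat.lt_floor_add_one _).le
    obtain ⟨δ, hδ, hδψ⟩ : ∃ δ > 0, ∀ x ∈ E, ∀ y, dist x y < δ → ψ y ≤ ψ x + η := by
      have := hE.uniformContinuousAt_of_continuousAt ψ (fun x _ => hψ.continuousAt)
        (Metric.dist_mem_uniformity hη)
      obtain ⟨δ, hδ, h2⟩ := Metric.mem_uniformity_dist.1 this
      refine ⟨δ, hδ, fun x hx y hxy => ?_⟩
      have h3 : dist (ψ x) (ψ y) < η := h2 hxy hx
      rw [Real.dist_eq, abs_lt] at h3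
      linarith [h3.1]
    -- Within `δ` of slice `k` the function is at most `(k + 1)η + η`: the top of the slice plus the
    -- oscillation.
    have hbound : ∀ ε : ℝ, ε ≤ δ → ∫⁻ x in Metric.thickening ε E, ENNReal.ofReal (ψ x) ≤
        ∑ k ∈ Finset.range N, ENNReal.ofReal ((k + 2) * η) *
          volume (Metric.thickening ε (S k)) := by
      intro ε hε
      have hsub : Metric.thickening ε E ⊆ ⋃ k ∈ Finset.range N, Metric.thickening ε (S k) := by
        refine (Metric.thickening_subset_of_subset ε hcov).trans (le_of_eq ?_)
        simp only [Metric.thickening_iUnion]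
      refine (lintegral_mono_set hsub).trans ?_
      refine (setLIntegral_biUnion_finset_le _ _ _).trans (Finset.sum_le_sum fun k _ => ?_)
      rw [← setLIntegral_const]
      refine setLIntegral_mono measurable_const fun y hy => ?_
      obtain ⟨x, hx, hxy⟩ := Metric.mem_thickening_iff.1 hy
      refine ENNReal.ofReal_le_ofReal ?_
      have h1 := hδψ x (hSE k hx) y (by rw [dist_comm]; exact hxy.trans_le hε)
      have h2 := hx.2.2
      linarith
    calc limsup (fun ε : ℝ => ENNReal.ofReal ((2 * ε) ^ (α - (n : ℝ))) *
          ∫⁻ x in Metric.thickening ε E, ENNReal.ofReal (ψ x)) (𝓝[>] 0)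
        ≤ limsup (fun ε : ℝ => ∑ k ∈ Finset.range N, ENNReal.ofReal ((k + 2) * η) *
            (ENNReal.ofReal ((2 * ε) ^ (α - (n : ℝ))) *
              volume (Metric.thickening ε (S k)))) (𝓝[>] 0) := by
          refine limsup_le_limsup ?_
          have : ∀ᶠ ε : ℝ in 𝓝[>] 0, ε ≤ δ :=
            nhdsWithin_le_nhds (eventually_le_nhds hδ)
          filter_upwards [this] with ε hε
          refine (mul_le_mul_right (hbound ε hε) _).trans (le_of_eq ?_)
          rw [Finset.mul_sum]
          refine Finset.sum_congr rfl fun k _ => ?_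
          ring
      _ ≤ ∑ k ∈ Finset.range N, ENNReal.ofReal ((k + 2) * η) *
            upperMinkowskiContent α (S k) := by
          refine (ENNReal.limsup_sum_le_sum _ _).trans (Finset.sum_le_sum fun k _ => ?_)
          rw [ENNReal.limsup_const_mul_of_ne_top ENNReal.ofReal_ne_top]
          rfl
      -- On slice `k`, `kη ≤ ψ`, hence `(k + 2)η ≤ ψ + 2η`; slices may be `ν`-null, so `h` is needed
      -- for them too.
      _ ≤ ∑ k ∈ Finset.range N, A * ∫⁻ x, (S k).indicator
            (fun x => ENNReal.ofReal (ψ x) + ENNReal.ofReal (2 * η)) x ∂ν := by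
          refine Finset.sum_le_sum fun k _ => ?_
          refine (mul_le_mul_right (h _ (hSE k) (hSc k)) _).trans ?_
          rw [mul_left_comm]
          refine mul_le_mul_right ?_ _
          rw [lintegral_indicator (hSc k).isClosed.measurableSet, ← setLIntegral_const]
          refine setLIntegral_mono (by fun_prop) fun x hx => ?_
          rw [← ENNReal.ofReal_add (hψ0 x) (by positivity)]
          refine ENNReal.ofReal_le_ofReal ?_
          have := hx.2.1
          linarith
      _ = A * ∫⁻ x, ∑ k ∈ Finset.range N, (S k).indicator
            (fun x => ENNReal.ofReal (ψ x) + ENNReal.ofReal (2 * η)) x ∂ν := by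
          rw [lintegral_finsetSum, Finset.mul_sum]
          exact fun k _ => Measurable.indicator (by fun_prop) (hSc k).isClosed.measurableSet
      _ ≤ A * ∫⁻ x, 2 * (ENNReal.ofReal (ψ x) + ENNReal.ofReal (2 * η)) ∂ν := by
          refine mul_le_mul_right (lintegral_mono fun x => ?_) _
          exact sum_indicator_levelSets_le E ψ hη N
            (fun x => ENNReal.ofReal (ψ x) + ENNReal.ofReal (2 * η)) x
      _ = _ := by
          rw [lintegral_const_mul _ (by fun_prop), lintegral_add_right _ measurable_const,
            lintegral_const]
          ring
  have hlim : Tendsto (fun η : ℝ => 2 * (A : ℝ≥0∞) *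
      (∫⁻ x, ENNReal.ofReal (ψ x) ∂ν + ENNReal.ofReal (2 * η) * ν univ)) (𝓝[>] 0)
      (𝓝 (2 * A * ∫⁻ x, ENNReal.ofReal (ψ x) ∂ν)) := by
    refine ENNReal.Tendsto.const_mul ?_ (Or.inr (by finiteness))
    have h1 : Tendsto (fun η : ℝ => ENNReal.ofReal (2 * η) * ν univ) (𝓝[>] 0) (𝓝 0) := by
      have h2 : Tendsto (fun η : ℝ => ENNReal.ofReal (2 * η)) (𝓝[>] 0) (𝓝 0) := by
        have h3 : Continuous fun η : ℝ => ENNReal.ofReal (2 * η) :=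
          ENNReal.continuous_ofReal.comp (continuous_const.mul continuous_id)
        simpa using (h3.tendsto 0).mono_left nhdsWithin_le_nhds
      simpa using ENNReal.Tendsto.mul_const h2 (Or.inr (measure_ne_top ν univ))
    simpa using h1.const_add (∫⁻ x, ENNReal.ofReal (ψ x) ∂ν)
  exact ge_of_tendsto hlim (eventually_mem_nhdsWithin.mono fun η hη => key η hη)

end Minkowski

/-! ### The `L²(ν)` bound and the density -/

section Representation

variable {n : ℕ}

/-- A functional on Schwartz functions which is bounded in `L²(ν)` is given by an `L²(ν)`
density. -/
theorem exists_density_of_enorm_sq_le {ν : Measure (EuclideanSpace ℝ (Fin n))} [IsFiniteMeasure ν]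
    {u : 𝓢'(EuclideanSpace ℝ (Fin n), ℂ)} {K : ℝ≥0∞} (hK : K ≠ ∞)
    (h : ∀ φ : 𝓢(EuclideanSpace ℝ (Fin n), ℂ), ‖u φ‖ₑ ^ 2 ≤ K * ∫⁻ x, ‖φ x‖ₑ ^ 2 ∂ν) :
    ∃ u₀ : EuclideanSpace ℝ (Fin n) → ℂ, MemLp u₀ 2 ν ∧
      (∀ φ : 𝓢(EuclideanSpace ℝ (Fin n), ℂ), u φ = ∫ x, φ x * u₀ x ∂ν) ∧
      ∫⁻ x, ‖u₀ x‖ₑ ^ 2 ∂ν ≤ K := by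
  have hsq : ∀ g : Lp ℂ 2 ν, ∫⁻ x, ‖g x‖ₑ ^ 2 ∂ν = ENNReal.ofReal (‖g‖ ^ 2) := by
    intro g
    have h1 : eLpNorm g 2 ν ^ 2 = ∫⁻ x, ‖g x‖ₑ ^ 2 ∂ν := by
      have := eLpNorm_nnreal_pow_eq_lintegral (μ := ν) (f := g) (p := 2) two_ne_zero
      simpa using this
    rw [← h1, Lp.norm_def, ENNReal.ofReal_pow ENNReal.toReal_nonneg,
      ENNReal.ofReal_toReal (Lp.eLpNorm_ne_top g)]
  set T : 𝓢(EuclideanSpace ℝ (Fin n), ℂ) →ₗ[ℂ] Lp ℂ 2 ν :=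
    (SchwartzMap.toLpCLM ℂ ℂ 2 ν : 𝓢(EuclideanSpace ℝ (Fin n), ℂ) →L[ℂ] Lp ℂ 2 ν).toLinearMap
    with hT
  have hTae : ∀ φ, T φ =ᵐ[ν] φ := fun φ => φ.coeFn_toLp 2 ν
  set R : ℝ := Real.sqrt K.toReal with hR
  have hR0 : 0 ≤ R := Real.sqrt_nonneg _
  have hbound : ∀ φ, ‖u φ‖ ≤ R * ‖T φ‖ := by
    intro φ
    have h1 := h φ
    have h2 : ∫⁻ x, ‖φ x‖ₑ ^ 2 ∂ν = ENNReal.ofReal (‖T φ‖ ^ 2) := by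
      rw [← hsq]
      refine lintegral_congr_ae ?_
      filter_upwards [hTae φ] with x hx
      rw [hx]
    rw [h2, ← ENNReal.ofReal_toReal hK, ← ENNReal.ofReal_mul ENNReal.toReal_nonneg, ← ofReal_norm,
      ← ENNReal.ofReal_pow (norm_nonneg _), ENNReal.ofReal_le_ofReal_iff (by positivity)] at h1
    refine le_of_sq_le_sq ?_ (by positivity)
    rwa [mul_pow, hR, Real.sq_sqrt ENNReal.toReal_nonneg]
  obtain ⟨s, hs⟩ := T.rangeRestrict.exists_rightInverse_of_surjective T.range_rangeRestrict
  have hs' : ∀ y, T (s y) = y := fun y => congrArg Subtype.val (LinearMap.congr_fun hs y)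
  set g : LinearMap.range T →ₗ[ℂ] ℂ := (u : 𝓢(EuclideanSpace ℝ (Fin n), ℂ) →ₗ[ℂ] ℂ).comp s
  have hg : ∀ y, ‖g y‖ ≤ R * ‖y‖ := fun y => by
    have := hbound (s y)
    rwa [hs'] at this
  -- By `hbound`, `u` vanishes on the kernel of `T`, so it factors through the range whatever
  -- section `s` was chosen.
  have hug : ∀ φ, u φ = g (T.rangeRestrict φ) := by
    intro φ
    have h1 := hbound (φ - s (T.rangeRestrict φ))
    rw [map_sub, map_sub, hs', show (T.rangeRestrict φ : Lp ℂ 2 ν) = T φ from rfl, sub_self,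
      norm_zero, mul_zero, norm_le_zero_iff, sub_eq_zero] at h1
    exact h1
  obtain ⟨G, hG, hGn⟩ := exists_extension_norm_eq (LinearMap.range T) (g.mkContinuous R hg)
  set w : Lp ℂ 2 ν := (InnerProductSpace.toDual ℂ (Lp ℂ 2 ν)).symm G with hw
  have hwn : ‖w‖ ≤ R := by
    rw [hw, LinearIsometryEquiv.norm_map, hGn]
    exact LinearMap.mkContinuous_norm_le _ hR0 _
  have hstar : ∀ x, ‖starRingEnd ℂ (w x)‖ₑ = ‖w x‖ₑ := fun x => by
    rw [← ofReal_norm, ← ofReal_norm, RCLike.norm_conj]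
  -- The inner product conjugates its first argument, so the density is the conjugate of the Riesz
  -- vector.
  refine ⟨fun x => starRingEnd ℂ (w x), (Lp.memLp w).star, fun φ => ?_, ?_⟩
  · have h1 : u φ = inner ℂ w (T φ) := by
      rw [hw, InnerProductSpace.toDual_symm_apply, hug]
      exact (hG (T.rangeRestrict φ)).symm
    rw [h1, L2.inner_def]
    refine integral_congr_ae ?_
    filter_upwards [hTae φ] with x hx
    rw [hx]
    simp [RCLike.inner_apply]
  · simp only [hstar]
    rw [hsq, ← ENNReal.ofReal_toReal hK]
    refine ENNReal.ofReal_le_ofReal ?_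
    rw [← Real.sq_sqrt (ENNReal.toReal_nonneg (a := K))]
    gcongr

/-- `L²`-growth of the Fourier transform controls a distribution supported in `E` by the `L²` norm
of test functions with respect to any measure which dominates the Minkowski content on `E`. -/
theorem enorm_apply_sq_le_of_growth {α : ℝ} (hα : 0 < α)
    {m : 𝓢(EuclideanSpace ℝ (Fin n), ℂ)} (hm0 : m 0 = 1)
    (hmχ : ∀ ε : ℝ, 0 < ε → ∃ χ : 𝓢(EuclideanSpace ℝ (Fin n), ℂ),
      Function.support χ ⊆ Metric.closedBall 0 ε ∧ ∀ ξ, 𝓕 χ ξ = m (ε • ξ))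
    {C : ℝ} (hmC : ∀ ξ, ‖m ξ‖ ≤ C * ((1 + ‖ξ‖) ^ n)⁻¹)
    {E : Set (EuclideanSpace ℝ (Fin n))} {ν : Measure (EuclideanSpace ℝ (Fin n))}
    [IsFiniteMeasure ν] (hE : IsCompact E) {A : ℝ≥0}
    (hA : ∀ S ⊆ E, IsCompact S → upperMinkowskiContent α S ≤ A * ν S)
    {u : 𝓢'(EuclideanSpace ℝ (Fin n), ℂ)} (hu : Distribution.dsupport u ⊆ E)
    {f : EuclideanSpace ℝ (Fin n) → ℂ} (hf : IsFunctionDistribution (𝓕 u) f)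
    {L₀ : ℝ} {M : ℝ≥0∞} (hM : M ≠ ∞)
    (h : ∀ L, L₀ ≤ L → ∫⁻ ξ in Metric.closedBall 0 L, ‖f ξ‖ₑ ^ 2 ≤
      M * ENNReal.ofReal (L ^ ((n : ℝ) - α)))
    (φ : 𝓢(EuclideanSpace ℝ (Fin n), ℂ)) :
    ‖u φ‖ₑ ^ 2 ≤ ENNReal.ofReal (C ^ 2) * dyadicConst n (n - α) *
      ENNReal.ofReal (6 ^ ((n : ℝ) - α)) * (2 * A) * M * ∫⁻ x, ‖φ x‖ₑ ^ 2 ∂ν := by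
  have hβ : (n : ℝ) - α < n := by linarith
  have hfm := hf.1.aestronglyMeasurable
  have hint := integrable_schwartz_mul_of_growth hf.1 hM hβ h
  have hv := hf.apply_eq_integral hint
  have hex : ∀ ε : ℝ, ∃ χ : 𝓢(EuclideanSpace ℝ (Fin n), ℂ), 0 < ε →
      Function.support χ ⊆ Metric.closedBall 0 ε ∧ ∀ ξ, 𝓕 χ ξ = m (ε • ξ) := by
    intro ε
    by_cases hε : 0 < ε
    · obtain ⟨χ, hχ⟩ := hmχ ε hε
      exact ⟨χ, fun _ => hχ⟩
    · exact ⟨0, fun h => absurd h hε⟩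
  choose χ hχ using hex
  have htend := tendsto_apply_convolution hv hint hfm hm0 (fun ε hε => (hχ ε hε).2) φ
  have htend2 : Tendsto (fun ε => ‖u (convolution (ContinuousLinearMap.mul ℂ ℂ) (χ ε) φ)‖ₑ ^ 2)
      (𝓝[>] 0) (𝓝 (‖u φ‖ₑ ^ 2)) :=
    ((ENNReal.continuous_pow 2).tendsto _).comp ((continuous_enorm.tendsto _).comp htend)
  set P : ℝ → ℝ≥0∞ := fun ε => ENNReal.ofReal ((2 * ε) ^ (α - (n : ℝ))) *
    ∫⁻ x in Metric.thickening ε E, ENNReal.ofReal (‖φ x‖ ^ 2) with hP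
  set c : ℝ≥0∞ := ENNReal.ofReal (C ^ 2) * dyadicConst n (n - α) *
    ENNReal.ofReal (6 ^ ((n : ℝ) - α)) * M with hc
  have hcfin : c ≠ ∞ := by
    have := (dyadicConst_lt_top hβ).ne
    finiteness
  have hnorm : ∀ x, ENNReal.ofReal (‖φ x‖ ^ 2) = ‖φ x‖ₑ ^ 2 := fun x => by
    rw [ENNReal.ofReal_pow (norm_nonneg _), ofReal_norm]
  have hle : ∀ᶠ ε : ℝ in 𝓝[>] 0,
      ‖u (convolution (ContinuousLinearMap.mul ℂ ℂ) (χ ε) φ)‖ₑ ^ 2 ≤ c * P (3 * ε) := by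
    have hpos : ∀ᶠ ε : ℝ in 𝓝[>] 0, 0 < ε := eventually_mem_nhdsWithin
    have hbig : ∀ᶠ ε : ℝ in 𝓝[>] 0, L₀ ≤ ε⁻¹ :=
      tendsto_inv_nhdsGT_zero.eventually (eventually_ge_atTop L₀)
    filter_upwards [hpos, hbig] with ε hε hεL
    have h1 := enorm_apply_convolution_sq_le_thickening hE hu hε (hχ ε hε).1
      (fun φ => enorm_apply_convolution_sq_le hv hfm h hmC hε hεL (hχ ε hε).2 φ) φ
    refine h1.trans (le_of_eq ?_)
    -- The neighbourhood has radius `3ε`, whose content normalisation is `(2 · 3ε)^(α-n)`; hence the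
    -- constant `6^(n-α)`.
    have h2 : ENNReal.ofReal (ε⁻¹ ^ ((n : ℝ) - α)) =
        ENNReal.ofReal (6 ^ ((n : ℝ) - α)) * ENNReal.ofReal ((2 * (3 * ε)) ^ (α - (n : ℝ))) := by
      rw [← ENNReal.ofReal_mul (by positivity)]
      congr 1
      rw [show 2 * (3 * ε) = 6 * ε by ring, Real.mul_rpow (by norm_num) hε.le, ← mul_assoc,
        ← Real.rpow_add (by norm_num), Real.inv_rpow hε.le, ← Real.rpow_neg hε.le]
      simp
    simp only [hP, hc, hnorm, h2]
    ring
  have hlim : limsup (fun ε => P (3 * ε)) (𝓝[>] 0) ≤ limsup P (𝓝[>] 0) := by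
    have h3 : Tendsto (fun ε : ℝ => 3 * ε) (𝓝[>] 0) (𝓝[>] 0) := by
      refine tendsto_nhdsWithin_iff.2 ⟨?_, ?_⟩
      · have : Continuous fun ε : ℝ => 3 * ε := by fun_prop
        simpa using (this.tendsto 0).mono_left nhdsWithin_le_nhds
      · filter_upwards [self_mem_nhdsWithin] with ε (hε : 0 < ε)
        exact mem_Ioi.2 (by positivity)
    change limsup (P ∘ fun ε => 3 * ε) _ ≤ _
    rw [limsup_comp]
    exact limsup_le_limsup_of_le h3
  have hMink := limsup_lintegral_thickening_le hE hA (ψ := fun x => ‖φ x‖ ^ 2)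
    (by have := φ.continuous; fun_prop) (fun x => by positivity)
  calc ‖u φ‖ₑ ^ 2 = limsup (fun ε =>
        ‖u (convolution (ContinuousLinearMap.mul ℂ ℂ) (χ ε) φ)‖ₑ ^ 2) (𝓝[>] 0) :=
        htend2.limsup_eq.symm
    _ ≤ limsup (fun ε => c * P (3 * ε)) (𝓝[>] 0) := limsup_le_limsup hle
    _ = c * limsup (fun ε => P (3 * ε)) (𝓝[>] 0) := ENNReal.limsup_const_mul_of_ne_top hcfin
    _ ≤ c * (2 * A * ∫⁻ x, ENNReal.ofReal (‖φ x‖ ^ 2) ∂ν) :=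
        mul_le_mul_right (hlim.trans hMink) _
    _ = _ := by
        simp only [hnorm, hc]
        ring

/-- Hölder's inequality on balls: growth of the `L^p` mass controls growth of the `L²` mass. -/
theorem lintegral_sq_closedBall_le {f : EuclideanSpace ℝ (Fin n) → ℂ}
    (hf : AEStronglyMeasurable f volume) {α p : ℝ} (hp : 2 ≤ p) {L : ℝ} (hL : 0 < L) {K : ℝ≥0∞}
    (h : ∫⁻ ξ in Metric.closedBall 0 L, ‖f ξ‖ₑ ^ p ≤
      K * ENNReal.ofReal (L ^ ((n : ℝ) - α * p / 2))) :
    ∫⁻ ξ in Metric.closedBall 0 L, ‖f ξ‖ₑ ^ 2 ≤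
      K ^ (2 / p) * volume (Metric.ball (0 : EuclideanSpace ℝ (Fin n)) 1) ^ (1 - 2 / p) *
        ENNReal.ofReal (L ^ ((n : ℝ) - α)) := by
  have hp0 : 0 < p := by linarith
  have hs : 0 ≤ 2 / p := by positivity
  have ht : 0 ≤ 1 - 2 / p := by
    rw [sub_nonneg, div_le_one hp0]; exact hp
  have h1 := ENNReal.lintegral_mul_norm_pow_le
    (μ := volume.restrict (Metric.closedBall (0 : EuclideanSpace ℝ (Fin n)) L))
    (f := fun ξ => ‖f ξ‖ₑ ^ p) (g := fun _ => 1) (hf.restrict.enorm.pow_const p)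
    aemeasurable_const hs ht (by ring)
  simp only [ENNReal.one_rpow, mul_one, lintegral_const, one_mul, Measure.restrict_apply_univ,
    ← ENNReal.rpow_mul] at h1
  rw [mul_div_cancel₀ _ hp0.ne'] at h1
  simp only [ENNReal.rpow_two] at h1
  refine h1.trans ((mul_le_mul_left (ENNReal.rpow_le_rpow h hs) _).trans (le_of_eq ?_))
  rw [Measure.addHaar_closedBall _ _ hL.le, finrank_euclideanSpace_fin,
    ENNReal.mul_rpow_of_nonneg _ _ hs, ENNReal.mul_rpow_of_nonneg _ _ ht,
    ENNReal.ofReal_rpow_of_nonneg (by positivity) hs, ENNReal.ofReal_rpow_of_nonneg (by positivity) ht]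
  -- The exponents match: `(n - αp/2)(2/p) + n(1 - 2/p) = n - α`.
  have h2 : L ^ ((n : ℝ) - α) = (L ^ ((n : ℝ) - α * p / 2)) ^ (2 / p) * (L ^ n) ^ (1 - 2 / p) := by
    rw [← Real.rpow_natCast, ← Real.rpow_mul hL.le, ← Real.rpow_mul hL.le, ← Real.rpow_add hL]
    congr 1
    field_simp
    ring
  rw [h2, ENNReal.ofReal_mul (by positivity)]
  ring

theorem exists_isFunctionDistribution_of_fourierLimsup_lt_top
    {u : 𝓢'(EuclideanSpace ℝ (Fin n), ℂ)} {α p : ℝ} (h : fourierLimsup u α p < ∞) :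
    ∃ f, IsFunctionDistribution (𝓕 u) f := by
  by_contra hne
  push Not at hne
  refine h.ne ?_
  -- With no representing function the infimum is over the empty set.
  have : ∀ L, lpMassOnBall (𝓕 u) p L = ∞ := fun L => by
    simp [lpMassOnBall, hne]
  simp [fourierLimsup, this, ENNReal.top_div_of_ne_top]

end Representation

/-! ### The main theorem -/

theorem theorem2p9 (n : ℕ) (α p : ℝ) (hα : 0 < α) (hαn : α < n)
    (hp : 2 ≤ p) (hpα : p < 2 * n / α) (A : ℝ≥0) :
    ∃ C : ℝ≥0, ∀ (E : Set (EuclideanSpace ℝ (Fin n))) (ν : Measure (EuclideanSpace ℝ (Fin n)))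
      [IsFiniteMeasure ν], IsCompact E → ν Eᶜ = 0 → ν ≠ 0 →
      (∀ S ⊆ E, IsCompact S → ν S ≠ 0 →
        0 < upperMinkowskiContent α S ∧ upperMinkowskiContent α S ≤ A * ν S) →
      ∀ u : 𝓢'(EuclideanSpace ℝ (Fin n), ℂ), Distribution.dsupport u ⊆ E →
        fourierLimsup u α p < ∞ →
        ∃ u₀ : EuclideanSpace ℝ (Fin n) → ℂ, MemLp u₀ 2 ν ∧
          (∀ φ : 𝓢(EuclideanSpace ℝ (Fin n), ℂ), u φ = ∫ x in E, φ x * u₀ x ∂ν) ∧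
          (∫⁻ x in E, ‖u₀ x‖ₑ ^ 2 ∂ν) ^ (p / 2) ≤ C * fourierLimsup u α p := by
  have hp0 : 0 < p := by linarith
  have hs : 0 ≤ 2 / p := by positivity
  have ht : 0 ≤ 1 - 2 / p := by
    rw [sub_nonneg, div_le_one hp0]; exact hp
  -- The mollifier is fixed before `E`, `ν` and `u`, so the constant depends only on `n`, `α`, `p`
  -- and `A`.
  obtain ⟨m, hm0, hmχ⟩ := exists_mollifier n
  obtain ⟨B, -, hB⟩ := m.exists_norm_le_inv_one_add_pow n
  set c : ℝ≥0∞ := ENNReal.ofReal (B ^ 2) * dyadicConst n (n - α) *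
    ENNReal.ofReal (6 ^ ((n : ℝ) - α)) * (2 * A) *
    volume (Metric.ball (0 : EuclideanSpace ℝ (Fin n)) 1) ^ (1 - 2 / p) with hc
  have hvol : volume (Metric.ball (0 : EuclideanSpace ℝ (Fin n)) 1) ^ (1 - 2 / p) ≠ ∞ :=
    ENNReal.rpow_ne_top_of_nonneg ht measure_ball_lt_top.ne
  have hcfin : c ≠ ∞ := by
    have := (dyadicConst_lt_top (show (n : ℝ) - α < n by linarith)).ne
    finiteness
  refine ⟨(c ^ (p / 2)).toNNReal, fun E ν _ hE hνE hν hA u hu hfin => ?_⟩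
  rw [ENNReal.coe_toNNReal (ENNReal.rpow_ne_top_of_nonneg (by positivity) hcfin),
    Measure.restrict_eq_self_of_ae_mem (show ∀ᵐ x ∂ν, x ∈ E from hνE)]
  obtain ⟨f, hf⟩ := exists_isFunctionDistribution_of_fourierLimsup_lt_top hfin
  have hA' : ∀ S ⊆ E, IsCompact S → upperMinkowskiContent α S ≤ A * ν S := fun S hSE hS =>
    upperMinkowskiContent_le_of_pos hα hE hνE hν hA hSE hS
  -- The mass bound holds for all large `L` only with a constant strictly above the limsup; `hmain`
  -- then lets `K` decrease to it.
  have hbound : ∀ K : ℝ≥0∞, K ≠ ∞ → fourierLimsup u α p < K →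
      ∀ φ : 𝓢(EuclideanSpace ℝ (Fin n), ℂ),
        ‖u φ‖ₑ ^ 2 ≤ c * (∫⁻ x, ‖φ x‖ₑ ^ 2 ∂ν) * K ^ (2 / p) := by
    intro K hK hlt φ
    obtain ⟨L₁, hL₁⟩ := eventually_atTop.1 (eventually_lt_of_limsup_lt hlt)
    have hgrowth : ∀ L, max L₁ 1 ≤ L → ∫⁻ ξ in Metric.closedBall 0 L, ‖f ξ‖ₑ ^ 2 ≤
        K ^ (2 / p) * volume (Metric.ball (0 : EuclideanSpace ℝ (Fin n)) 1) ^ (1 - 2 / p) *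
          ENNReal.ofReal (L ^ ((n : ℝ) - α)) := by
      intro L hL
      have hL0 : 0 < L := lt_of_lt_of_le one_pos ((le_max_right _ _).trans hL)
      refine lintegral_sq_closedBall_le hf.1.aestronglyMeasurable hp hL0 ?_
      rw [← hf.lpMassOnBall_eq]
      have h1 := (hL₁ L ((le_max_left _ _).trans hL)).le
      rwa [ENNReal.div_le_iff (ENNReal.ofReal_pos.2 (by positivity)).ne'
        ENNReal.ofReal_ne_top] at h1
    have h2 := enorm_apply_sq_le_of_growth hα hm0 hmχ hB hE hA' hu hf
      (ENNReal.mul_ne_top (ENNReal.rpow_ne_top_of_nonneg hs hK) hvol) hgrowth φ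
    refine h2.trans (le_of_eq ?_)
    rw [hc]
    ring
  have hmain : ∀ φ : 𝓢(EuclideanSpace ℝ (Fin n), ℂ),
      ‖u φ‖ₑ ^ 2 ≤ c * fourierLimsup u α p ^ (2 / p) * ∫⁻ x, ‖φ x‖ₑ ^ 2 ∂ν := by
    intro φ
    have hI : ∫⁻ x, ‖φ x‖ₑ ^ 2 ∂ν ≠ ∞ := by
      have := lintegral_rpow_enorm_lt_top_of_eLpNorm_lt_top two_ne_zero ENNReal.ofNat_ne_top
        (φ.memLp 2 ν).2
      simpa using this.ne
    have hlim : Tendsto (fun δ : ℝ => c * (∫⁻ x, ‖φ x‖ₑ ^ 2 ∂ν) *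
        (fourierLimsup u α p + ENNReal.ofReal δ) ^ (2 / p)) (𝓝[>] 0)
        (𝓝 (c * (∫⁻ x, ‖φ x‖ₑ ^ 2 ∂ν) * fourierLimsup u α p ^ (2 / p))) := by
      refine ENNReal.Tendsto.const_mul ?_ (Or.inr (ENNReal.mul_ne_top hcfin hI))
      have h1 : Continuous fun δ : ℝ => (fourierLimsup u α p + ENNReal.ofReal δ) ^ (2 / p) :=
        ENNReal.continuous_rpow_const.comp (continuous_const.add ENNReal.continuous_ofReal)
      simpa using (h1.tendsto 0).mono_left nhdsWithin_le_nhds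
    rw [mul_right_comm]
    refine ge_of_tendsto hlim ?_
    filter_upwards [self_mem_nhdsWithin] with δ (hδ : 0 < δ)
    exact hbound _ (by finiteness)
      (ENNReal.lt_add_right hfin.ne (ENNReal.ofReal_pos.2 hδ).ne') φ
  obtain ⟨u₀, hu₀, hrep, hle⟩ := exists_density_of_enorm_sq_le
    (ENNReal.mul_ne_top hcfin (ENNReal.rpow_ne_top_of_nonneg hs hfin.ne)) hmain
  refine ⟨u₀, hu₀, hrep, ?_⟩
  refine (ENNReal.rpow_le_rpow hle (by positivity)).trans (le_of_eq ?_)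
  rw [ENNReal.mul_rpow_of_nonneg _ _ (by positivity), ← ENNReal.rpow_mul,
    show 2 / p * (p / 2) = 1 by field_simp, ENNReal.rpow_one]
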